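/- Let $n\ge 2$ and let $$\overline{\Pi}_n=\operatorname{conv}\{(\varepsilon_1\pi(1),\ldots,\varepsilon_n\pi(n)) : \pi\in S_n,\ \varepsilon_1,\ldots,\varepsilon_n\in\{+1,-1\}\}\subset\mathbb{R}^n$$ be the $B$-permutahedron. Let $G(\overline{\Pi}_n)$ denote its skeleton, that is, the graph formed by the vertices and edges ($0$- and $1$-dimensional faces) of $\overline{\Pi}_n$. Then $\overline{\Pi}_n$ has a facet-Hamiltonian cycle: there is a cycle $C$ in the graph $G(\overline{\Pi}_n)$ such that for every facet $F$ (face of dimension $n-1$) of $\overline{\Pi}_n$, the intersection $C\cap F$, i.e. the subgraph of $C$ formed by its vertices and edges that lie in $F$, is nonempty and connected. -/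

import Mathlib

section Polytope

variable {E : Type*} [AddCommGroup E] [Module ℝ E] [TopologicalSpace E]

/-- The dimension of a convex set, i.e. of its affine hull (used for nonempty sets only). -/
noncomputable def polytopeDim (F : Set E) : ℕ :=
  Module.finrank ℝ (vectorSpan ℝ F)

/-- `F` is a facet of the polytope `P`: a nonempty face (the set of maximizers over `P` of a linear
functional) of dimension `dim P - 1`. -/
def IsFacet (P F : Set E) : Prop :=
  F.Nonempty ∧ IsExposed ℝ P F ∧ polytopeDim F + 1 = polytopeDim P

/-- The skeleton of the polytope `P`: its vertices are the vertices (zero-dimensional faces) of `P`,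
and two distinct vertices are adjacent if the segment joining them is a face of `P`. -/
def skeleton (P : Set E) : SimpleGraph (P.exposedPoints ℝ) where
  Adj u v := u ≠ v ∧ IsExposed ℝ P (segment ℝ (u : E) (v : E))
  symm := ⟨fun u v h => ⟨h.1.symm, by rw [segment_symm]; exact h.2⟩⟩
  loopless := ⟨fun _ h => h.1 rfl⟩

/-- The part of the skeleton of `P` that lies in the face `F`. -/
def skeletonIn (P F : Set E) : (skeleton P).Subgraph :=
  (⊤ : (skeleton P).Subgraph).induce {v | (v : E) ∈ F}

/-- A closed walk `c` in the skeleton of `P` is a facet-Hamiltonian cycle if it is a cycle and its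
intersection with every facet of `P` is nonempty and connected
(`SimpleGraph.Subgraph.Connected` includes nonemptiness). -/
def IsFacetHamiltonianCycle (P : Set E) {v : P.exposedPoints ℝ} (c : (skeleton P).Walk v v) :
    Prop :=
  c.IsCycle ∧ ∀ F : Set E, IsFacet P F → (c.toSubgraph ⊓ skeletonIn P F).Connected

end Polytope

/-- The signed permutation `(ε₁ π(1), …, εₙ π(n))` as a point of `ℝⁿ`; since `Fin n` is
`{0, …, n - 1}`, its values are shifted by one. -/
def signedPermPoint {n : ℕ} (π : Equiv.Perm (Fin n)) (ε : Fin n → ℤˣ) : Fin n → ℝ :=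
  fun i => ((ε i : ℤ) : ℝ) * (((π i : ℕ) : ℝ) + 1)

/-- The `B`-permutahedron: the convex hull of all signed permutations of `{1, …, n}`. -/
def BPermutahedron (n : ℕ) : Set (Fin n → ℝ) :=
  convexHull ℝ {x | ∃ (π : Equiv.Perm (Fin n)) (ε : Fin n → ℤˣ), x = signedPermPoint π ε}

/-! A signed permutation is recorded as a word: its indices with their signs, in order of decreasing
absolute value. Exchanging two neighbouring letters, or changing the sign of the last one, moves
along an edge of the polytope (`isExposed_segment_of_adj`). Every facet comes from a nonempty
partial sign vector `σ`, and its vertices are the words with a prefix made up of exactly the signed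
letters of `σ` (`IsFacet.exists_prefixSigns`). There are `3 ^ n - 1` nonempty `σ`.

Connectedness follows by counting. A step changes only one prefix as a set, so it enters at most one
`σ` (`IsPrefixSigns.eq_of_adj`). A closed walk that meets all partial sign vectors also has words
outside each nonempty `σ`, namely where one sign of `σ` is reversed, so it enters each `σ` at least
once. If it has only `3 ^ n - 1` steps, it enters each exactly once (`entry_unique`), and its words
in a facet form a single arc (`SimpleGraph.Walk.connected_inf_induce_of_unique_entry`).

It remains to build a cycle of this length meeting every `σ`. Subsets are handled by carrying a
letter from front to back between a path and its reverse (`exists_rotation_path`). A letter with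
free sign is handled by running a path with its sign fixed until it stands last, turning the sign,
bringing it to the front and running a path behind it (`exists_signed_path`). Two such paths with a
common end close up to the cycle (`exists_signed_cycle`). -/

open SimpleGraph

/-! ### Graphs of words and gluing of paths -/

/-- Two lists are adjacent if they differ by exchanging two neighbouring distinct entries. -/
def adjSwapGraph (α : Type*) : SimpleGraph (List α) where
  Adj w w' := ∃ a x y b, x ≠ y ∧ w = a ++ x :: y :: b ∧ w' = a ++ y :: x :: b
  symm := ⟨fun _ _ ⟨a, x, y, b, h, h₁, h₂⟩ => ⟨a, y, x, b, h.symm, h₂, h₁⟩⟩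
  loopless := ⟨fun w ⟨a, x, y, b, h, h₁, h₂⟩ => by
    subst h₁
    simp at h₂
    exact h h₂.1⟩

/-- A signed letter with its sign changed. -/
def negLetter {ι : Type*} (a : ι × ℤˣ) : ι × ℤˣ := (a.1, -a.2)

@[simp] lemma negLetter_fst {ι : Type*} (a : ι × ℤˣ) : (negLetter a).1 = a.1 := rfl

@[simp] lemma negLetter_negLetter {ι : Type*} (a : ι × ℤˣ) : negLetter (negLetter a) = a := by
  simp [negLetter]

lemma negLetter_ne {ι : Type*} (a : ι × ℤˣ) : negLetter a ≠ a := fun h =>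
  units_ne_neg_self a.2 (congrArg Prod.snd h).symm

/-- Two words in signed letters are adjacent if they differ by exchanging two neighbouring letters
or by the sign of the last letter. -/
def signedWordGraph (ι : Type*) : SimpleGraph (List (ι × ℤˣ)) where
  Adj w w' := (adjSwapGraph (ι × ℤˣ)).Adj w w' ∨ ∃ a x, w = a ++ [x] ∧ w' = a ++ [negLetter x]
  symm := ⟨fun w w' h => h.imp (fun h => h.symm) fun ⟨a, x, h₁, h₂⟩ =>
    ⟨a, negLetter x, h₂, by simpa using h₁⟩⟩
  loopless := ⟨fun w h => h.elim (fun h => h.ne rfl) fun ⟨a, x, h₁, h₂⟩ => by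
    subst h₁
    simp only [List.append_cancel_left_eq, List.cons.injEq, and_true] at h₂
    exact negLetter_ne x h₂.symm⟩

lemma adjSwapGraph_le_signedWordGraph (ι : Type*) :
    adjSwapGraph (ι × ℤˣ) ≤ signedWordGraph ι := fun _ _ h => Or.inl h

/-- Prepending a letter preserves adjacency by exchanges. -/
def adjSwapGraph.consHom {α : Type*} (x : α) : adjSwapGraph α →g adjSwapGraph α where
  toFun := List.cons x
  map_rel' := by
    rintro _ _ ⟨a, y, z, b, h, rfl, rfl⟩
    exact ⟨x :: a, y, z, b, h, rfl, rfl⟩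

/-- Appending a letter preserves adjacency by exchanges. -/
def adjSwapGraph.concatHom {α : Type*} (x : α) : adjSwapGraph α →g adjSwapGraph α where
  toFun w := w ++ [x]
  map_rel' := by
    rintro _ _ ⟨a, y, z, b, h, rfl, rfl⟩
    exact ⟨a, y, z, b ++ [x], h, by simp, by simp⟩

/-- Prepending a letter preserves adjacency of signed words. -/
def signedWordGraph.consHom {ι : Type*} (x : ι × ℤˣ) :
    signedWordGraph ι →g signedWordGraph ι where
  toFun := List.cons x
  map_rel' := by
    rintro _ _ (h | ⟨a, y, rfl, rfl⟩)
    · exact Or.inl ((adjSwapGraph.consHom x).map_rel' h)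
    · exact Or.inr ⟨x :: a, y, rfl, rfl⟩

@[simp] lemma adjSwapGraph.consHom_apply {α : Type*} (x : α) (w : List α) :
    adjSwapGraph.consHom x w = x :: w := rfl

@[simp] lemma adjSwapGraph.concatHom_apply {α : Type*} (x : α) (w : List α) :
    adjSwapGraph.concatHom x w = w ++ [x] := rfl

@[simp] lemma signedWordGraph.consHom_apply {ι : Type*} (x : ι × ℤˣ) (w : List (ι × ℤˣ)) :
    signedWordGraph.consHom x w = x :: w := rfl

lemma SimpleGraph.Walk.IsPath.append_of_inter {V : Type*} {G : SimpleGraph V} {u v w : V}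
    {p : G.Walk u v} {q : G.Walk v w} (hp : p.IsPath) (hq : q.IsPath)
    (h : ∀ x ∈ p.support, x ∈ q.support → x = v) : (p.append q).IsPath := by
  rw [Walk.isPath_def] at *
  rw [Walk.support_append, List.nodup_append]
  have hq' := hq
  rw [← Walk.cons_tail_support] at hq'
  rw [List.nodup_cons] at hq'
  refine ⟨hp, hq'.2, fun a ha b hb hab => ?_⟩
  subst hab
  have := h a ha (List.mem_of_mem_tail hb)
  subst this
  exact hq'.1 hb

/-- Leaving the endpoints as variables avoids casts when the image words are only propositionally of
the desired form. -/
lemma SimpleGraph.Walk.IsPath.exists_map {V V' : Type*} {G : SimpleGraph V} {G' : SimpleGraph V'}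
    (f : G →g G') (hf : Function.Injective f) {u v : V} {W : G.Walk u v} (hW : W.IsPath)
    {u' v' : V'} (hu : f u = u') (hv : f v = v') :
    ∃ A : G'.Walk u' v', A.IsPath ∧ A.length = W.length ∧
      ∀ w, w ∈ A.support ↔ ∃ w₀ ∈ W.support, f w₀ = w := by
  subst hu hv
  exact ⟨W.map f, hW.map hf, W.length_map f, fun w => by simp⟩

/-! ### Paths through all subsets of letters -/

/-- A path of words moving the first letter through the whole word to the end. -/
lemma exists_ascending_path {α : Type*} (x : α) (u : List α) (hx : x ∉ u) :
    ∃ D : (adjSwapGraph α).Walk (x :: u) (u ++ [x]), D.IsPath ∧ D.length = u.length ∧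
      ∀ w ∈ D.support, ∃ a b, a ++ b = u ∧ w = a ++ x :: b := by
  induction u with
  | nil => exact ⟨Walk.nil, by simp, rfl, by simp⟩
  | cons y u ih =>
    simp only [List.mem_cons, not_or] at hx
    obtain ⟨D, hD, hl, hs⟩ := ih hx.2
    have hadj : (adjSwapGraph α).Adj (x :: y :: u) (y :: x :: u) :=
      ⟨[], x, y, u, hx.1, rfl, rfl⟩
    obtain ⟨A, hA, hAl, hAs⟩ := hD.exists_map (adjSwapGraph.consHom y) List.cons_injective
      (u' := y :: x :: u) (v' := y :: u ++ [x]) rfl rfl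
    refine ⟨Walk.cons hadj A, ?_, by simp [hl, hAl], ?_⟩
    · rw [Walk.cons_isPath_iff]
      refine ⟨hA, fun h => ?_⟩
      obtain ⟨w₀, -, h⟩ := (hAs _).1 h
      simp only [adjSwapGraph.consHom_apply, List.cons.injEq] at h
      exact hx.1 h.1.symm
    · intro w hw
      rw [Walk.support_cons, List.mem_cons, hAs] at hw
      rcases hw with rfl | ⟨w, hw, rfl⟩
      · exact ⟨[], y :: u, rfl, rfl⟩
      · obtain ⟨a, b, rfl, rfl⟩ := hs w hw
        exact ⟨y :: a, b, rfl, rfl⟩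

/-- A path of words from `x :: u` to `u ++ [x]` whose prefixes run through all sets of letters, with
as few steps as possible. -/
lemma exists_rotation_path {α : Type*} (x : α) (u : List α) (hu : (x :: u).Nodup) :
    ∃ W : (adjSwapGraph α).Walk (x :: u) (u ++ [x]), W.IsPath ∧
      W.length + (u.length + 2) = 2 ^ (u.length + 1) ∧
      (∀ w ∈ W.support, w.Perm (x :: u)) ∧
      ∀ T : Set α, (∀ a ∈ T, a ∈ x :: u) → ∃ w ∈ W.support, ∃ k, ∀ a, a ∈ w.take k ↔ a ∈ T := by
  induction u generalizing x with
  | nil =>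
    refine ⟨Walk.nil, by simp, by simp, by simp, fun T hT => ⟨[x], by simp, ?_⟩⟩
    by_cases hx : x ∈ T
    · refine ⟨1, fun a => ⟨?_, fun h => by simpa using hT a h⟩⟩
      simp only [List.take_succ_cons, List.take_zero, List.mem_cons, List.not_mem_nil, or_false]
      rintro rfl
      exact hx
    · refine ⟨0, fun a => ⟨by simp, fun h => ?_⟩⟩
      have := hT a h
      simp only [List.mem_cons, List.not_mem_nil, or_false] at this
      exact absurd (this ▸ h) hx
  | cons y v ih =>
    obtain ⟨W₀, hp, hl, hs, hc⟩ := ih y (List.nodup_cons.1 hu).2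
    have hx : x ∉ y :: v := (List.nodup_cons.1 hu).1
    have hx' : x ∉ v ++ [y] := by simpa [and_comm, or_comm] using hx
    obtain ⟨D, hDp, hDl, hDs⟩ := exists_ascending_path x (v ++ [y]) hx'
    obtain ⟨A, hAp, hAl, hA⟩ := hp.exists_map (adjSwapGraph.consHom x) List.cons_injective
      (u' := x :: y :: v) (v' := x :: (v ++ [y])) rfl rfl
    obtain ⟨B, hBp, hBl, hB⟩ := hp.reverse.exists_map (adjSwapGraph.concatHom x)
      (List.append_left_injective _) (u' := v ++ [y] ++ [x]) (v' := y :: v ++ [x]) rfl rfl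
    simp only [Walk.support_reverse, List.mem_reverse, adjSwapGraph.consHom_apply,
      adjSwapGraph.concatHom_apply, Walk.length_reverse] at hA hB hBl
    -- `A` keeps `x` in front and meets the sets containing `x`; `D` carries `x` to the end; `B`
    -- runs backwards with `x` last and meets the sets avoiding `x`. With `k = v.length + 1` the
    -- length is `2 * (2 ^ k - k - 1) + k = 2 ^ (k + 1) - (k + 1) - 1`.
    refine ⟨A.append (D.append B), ?_, ?_, ?_, ?_⟩
    · refine hAp.append_of_inter (hDp.append_of_inter hBp ?_) ?_
      · intro w hw hw'
        obtain ⟨a, b, hab, rfl⟩ := hDs w hw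
        obtain ⟨w₀, hw₀, h⟩ := (hB _).1 hw'
        rcases List.eq_nil_or_concat b with rfl | ⟨b, z, rfl⟩
        · simp only [List.append_nil] at hab
          simp [hab]
        · rw [List.concat_eq_append] at h hab
          rw [← List.cons_append, ← List.append_assoc] at h
          have := List.append_inj_right' h rfl
          simp only [List.cons.injEq, and_true] at this
          subst this
          exact absurd (hab ▸ by simp) hx'
      · intro w hw hw'
        obtain ⟨w₀, hw₀, rfl⟩ := (hA w).1 hw
        rw [Walk.mem_support_append_iff] at hw'
        rcases hw' with hw' | hw'
        · obtain ⟨a, b, hab, h⟩ := hDs _ hw'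
          cases a with
          | nil =>
            simp only [List.nil_append] at h hab
            simp [h, hab]
          | cons z a =>
            simp only [List.cons_append, List.cons.injEq] at h
            exact absurd (hab ▸ by simp [h.1]) hx'
        · obtain ⟨w₁, hw₁, h⟩ := (hB _).1 hw'
          have h1 := hs _ hw₁
          cases w₁ with
          | nil => simp at h1
          | cons z w₁ =>
            simp only [List.cons_append, List.cons.injEq] at h
            exact absurd (h1.subset (by simp [h.1])) hx
    · simp only [Walk.length_append, hAl, hBl, hDl, List.length_append, List.length_cons,
        List.length_nil] at *
      rw [pow_succ]
      omega
    · intro w hw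
      simp only [Walk.mem_support_append_iff] at hw
      rcases hw with hw | hw | hw
      · obtain ⟨w₀, hw₀, rfl⟩ := (hA w).1 hw
        exact (hs _ hw₀).cons x
      · obtain ⟨a, b, hab, rfl⟩ := hDs w hw
        refine List.perm_middle.trans (List.Perm.cons x ?_)
        rw [hab]
        exact List.perm_append_singleton y v
      · obtain ⟨w₀, hw₀, rfl⟩ := (hB w).1 hw
        exact (List.perm_append_singleton x w₀).trans ((hs _ hw₀).cons x)
    · intro T hT
      by_cases hxT : x ∈ T
      · obtain ⟨w, hw, k, hk⟩ := hc (T \ {x}) (fun a ha => by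
          have := hT a ha.1
          rw [List.mem_cons] at this
          exact this.resolve_left ha.2)
        refine ⟨x :: w, ?_, k + 1, fun a => ?_⟩
        · exact Walk.mem_support_append_iff _ _ |>.2 (Or.inl ((hA _).2 ⟨w, hw, rfl⟩))
        · rw [List.take_succ_cons, List.mem_cons, hk]
          by_cases hax : a = x <;> simp [hax, hxT]
      · obtain ⟨w, hw, k, hk⟩ := hc T (fun a ha => by
          have := hT a ha
          rw [List.mem_cons] at this
          exact this.resolve_left (by rintro rfl; exact hxT ha))
        -- The bound `k` may exceed the length of `w`; the minimum keeps the appended `x` out of the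
        -- prefix.
        refine ⟨w ++ [x], ?_, min k w.length, fun a => ?_⟩
        · simp only [Walk.mem_support_append_iff]
          exact Or.inr (Or.inr ((hB _).2 ⟨w, hw, rfl⟩))
        · rw [List.take_append_of_le_length (min_le_right _ _), ← hk,
            List.take_eq_take_iff.2 (by simp : min (min k w.length) w.length = min k w.length)]

/-! ### Paths and cycles through all partial sign vectors -/

/-- Some prefix of the word `w` consists of the letters given by the partial sign vector `σ`. -/
def IsPrefixSigns {ι : Type*} (σ : ι → Option ℤˣ) (w : List (ι × ℤˣ)) : Prop :=
  ∃ k, ∀ i s, (i, s) ∈ w.take k ↔ σ i = some s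

lemma eq_neg_of_ne_units {s t : ℤˣ} (h : s ≠ t) : s = -t := by
  rcases Int.units_eq_one_or s with rfl | rfl <;> rcases Int.units_eq_one_or t with rfl | rfl <;>
    simp_all

lemma eq_of_fst_eq_of_nodup {ι : Type*} {w : List (ι × ℤˣ)} (hw : (w.map Prod.fst).Nodup)
    {a b : ι × ℤˣ} (ha : a ∈ w) (hb : b ∈ w) (h : a.1 = b.1) : a = b :=
  List.inj_on_of_nodup_map hw ha hb h

/-- Prepending the letter `x` to a word with prefix signs `σ` gives one with prefix signs
`σ` and `x`. -/
lemma IsPrefixSigns.cons {ι : Type*} [DecidableEq ι] {σ : ι → Option ℤˣ} {w : List (ι × ℤˣ)}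
    {x : ι × ℤˣ} (hx : σ x.1 = some x.2) (h : IsPrefixSigns (Function.update σ x.1 none) w) :
    IsPrefixSigns σ (x :: w) := by
  obtain ⟨k, hk⟩ := h
  refine ⟨k + 1, fun i s => ?_⟩
  rw [List.take_succ_cons, List.mem_cons, hk]
  by_cases hi : i = x.1
  · subst hi
    simp [hx, Prod.ext_iff, eq_comm]
  · simp [hi, Prod.ext_iff]

/-- A path ending in `B ++ [x]` with constant letter `x` continues through a change of the sign of
`x`, the descent of the changed letter to the front, and a path from `B` to `C`. -/
lemma exists_turned_path {ι : Type*} {A B C : List (ι × ℤˣ)} {x : ι × ℤˣ}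
    (hB : ((B ++ [x]).map Prod.fst).Nodup)
    {W₁ : (signedWordGraph ι).Walk A (B ++ [x])} (h₁ : W₁.IsPath)
    (hs₁ : ∀ w ∈ W₁.support, (w.map Prod.fst).Nodup ∧ x ∈ w)
    {W₂ : (signedWordGraph ι).Walk B C} (h₂ : W₂.IsPath) :
    ∃ W : (signedWordGraph ι).Walk A (negLetter x :: C), W.IsPath ∧
      W.length = W₁.length + 1 + B.length + W₂.length ∧
      (∀ w ∈ W.support, w ∈ W₁.support ∨
        (∃ a b, a ++ b = B ∧ w = a ++ negLetter x :: b) ∨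
        ∃ w₀ ∈ W₂.support, w = negLetter x :: w₀) ∧
      (∀ w ∈ W₁.support, w ∈ W.support) ∧ ∀ w ∈ W₂.support, negLetter x :: w ∈ W.support := by
  have hxB : ∀ a ∈ B, a.1 ≠ x.1 := by
    rw [List.map_append, List.nodup_append] at hB
    exact fun a ha => hB.2.2 _ (List.mem_map_of_mem ha) _ (by simp)
  have hxB' : negLetter x ∉ B := fun h => hxB _ h rfl
  obtain ⟨D', hD', hDl', hDs'⟩ := exists_ascending_path (negLetter x) B hxB'
  obtain ⟨D, hD, hDl, hDs⟩ := hD'.reverse.exists_map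
    (Hom.ofLE (adjSwapGraph_le_signedWordGraph ι)) (fun _ _ h => h)
    (u' := B ++ [negLetter x]) (v' := negLetter x :: B) rfl rfl
  have hDs : ∀ w, w ∈ D.support ↔ w ∈ D'.support := fun w => by simp [hDs]
  rw [Walk.length_reverse] at hDl
  obtain ⟨E, hE, hEl, hEs⟩ := h₂.exists_map (signedWordGraph.consHom (negLetter x))
    List.cons_injective (u' := negLetter x :: B) (v' := negLetter x :: C) rfl rfl
  have hadj : (signedWordGraph ι).Adj (B ++ [x]) (B ++ [negLetter x]) := Or.inr ⟨B, x, rfl, rfl⟩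
  have hDE : (D.append E).IsPath := by
    refine hD.append_of_inter hE fun w hw hw' => ?_
    obtain ⟨a, b, hab, rfl⟩ := hDs' w ((hDs w).1 hw)
    obtain ⟨w₀, hw₀, h⟩ := (hEs _).1 hw'
    cases a with
    | nil =>
      rw [List.nil_append] at hab
      simp [hab]
    | cons y a =>
      simp only [signedWordGraph.consHom_apply, List.cons_append, List.cons.injEq] at h
      exact absurd (hab ▸ by simp [h.1]) hxB'
  have hneg : ∀ w ∈ (D.append E).support, negLetter x ∈ w := by
    intro w hw
    rw [Walk.mem_support_append_iff, hDs, hEs] at hw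
    rcases hw with hw | ⟨w, hw, rfl⟩
    · obtain ⟨a, b, hab, rfl⟩ := hDs' w hw
      simp
    · simp
  have hcons : (Walk.cons hadj (D.append E)).IsPath := by
    rw [Walk.cons_isPath_iff]
    refine ⟨hDE, fun h => ?_⟩
    exact negLetter_ne x (eq_of_fst_eq_of_nodup hB (hneg _ h) (by simp) rfl)
  refine ⟨W₁.append (Walk.cons hadj (D.append E)), ?_, ?_, ?_, ?_, ?_⟩
  · refine h₁.append_of_inter hcons fun w hw hw' => ?_
    rw [Walk.support_cons, List.mem_cons] at hw'
    refine hw'.resolve_right fun hw' => negLetter_ne x ?_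
    exact eq_of_fst_eq_of_nodup (hs₁ w hw).1 (hneg _ hw') (hs₁ w hw).2 rfl
  · simp only [Walk.length_append, Walk.length_cons, hDl, hDl', hEl]
    omega
  · intro w hw
    rw [Walk.mem_support_append_iff, Walk.support_cons, List.mem_cons, Walk.mem_support_append_iff,
      hEs, hDs] at hw
    rcases hw with hw | rfl | hw | ⟨w, hw, rfl⟩
    · exact Or.inl hw
    · exact Or.inl W₁.end_mem_support
    · exact Or.inr (Or.inl (hDs' w hw))
    · exact Or.inr (Or.inr ⟨w, hw, rfl⟩)
  · exact fun w hw => (Walk.mem_support_append_iff _ _).2 (Or.inl hw)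
  · intro w hw
    rw [Walk.mem_support_append_iff, Walk.support_cons, List.mem_cons, Walk.mem_support_append_iff,
      hEs]
    exact Or.inr (Or.inr (Or.inr ⟨w, hw, rfl⟩))

/-- The prefix signs that are to occur on a path from `p ++ v`: the letters of `v` keep their
signs, those of `p` may change them. -/
def IsCompatible {ι : Type*} (p v : List (ι × ℤˣ)) (σ : ι → Option ℤˣ) : Prop :=
  ∀ i s, σ i = some s → i ∈ (p ++ v).map Prod.fst ∧ (i ∈ v.map Prod.fst → (i, s) ∈ v)

/-- Before the sign of `x` is turned, `x` counts as a letter with fixed sign. That stage deals with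
every `σ` that does not ask for the opposite sign. -/
lemma IsCompatible.of_turn {ι : Type*} {q v : List (ι × ℤˣ)} {x : ι × ℤˣ} {σ : ι → Option ℤˣ}
    (hσ : IsCompatible (q ++ [x]) v σ) (hx : σ x.1 ≠ some (-x.2)) : IsCompatible q (x :: v) σ := by
  intro i s his
  obtain ⟨h₁, h₂⟩ := hσ i s his
  refine ⟨by simpa using h₁, fun hi => ?_⟩
  rw [List.map_cons, List.mem_cons] at hi
  rcases hi with rfl | hi
  · by_cases hs : s = x.2
    · simp [hs]
    · exact absurd (eq_neg_of_ne_units hs ▸ his) hx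
  · exact List.mem_cons_of_mem _ (h₂ hi)

/-- After the turn, the changed letter stays in front and supplies its own entry of `σ`; only the
remaining entries are left to the path behind it. -/
lemma IsCompatible.update {ι : Type*} [DecidableEq ι] {q v : List (ι × ℤˣ)} {x : ι × ℤˣ}
    {σ : ι → Option ℤˣ} (hσ : IsCompatible (q ++ [x]) v σ) :
    IsCompatible q v (Function.update σ x.1 none) := by
  intro i s his
  by_cases hi : i = x.1
  · subst hi
    simp at his
  · rw [Function.update_of_ne hi] at his
    obtain ⟨h₁, h₂⟩ := hσ i s his
    refine ⟨?_, h₂⟩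
    simp only [List.append_assoc, List.map_append, List.mem_append, List.map_cons, List.map_nil,
      List.mem_cons, hi, List.not_mem_nil, false_or] at h₁ ⊢
    exact h₁

/-- A path that runs through all prefix signs on `p ++ v` with arbitrary signs of the letters of `p`
and the given signs of the letters of `v`, with as few steps as possible. -/
lemma exists_signed_path {ι : Type*} [DecidableEq ι] (p : List (ι × ℤˣ)) :
    ∃ p', ∀ v, ((p ++ v).map Prod.fst).Nodup →
      ∃ W : (signedWordGraph ι).Walk (p ++ v) (p' ++ v.rotate 1), W.IsPath ∧
        W.length + 1 + (p.length + v.length) = 2 ^ v.length * 3 ^ p.length ∧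
        (∀ w ∈ W.support, (w.map Prod.fst).Perm ((p ++ v).map Prod.fst) ∧ ∀ a ∈ v, a ∈ w) ∧
        ∀ σ, IsCompatible p v σ → ∃ w ∈ W.support, IsPrefixSigns σ w := by
  obtain ⟨m, hm⟩ : ∃ m, p.length = m := ⟨_, rfl⟩
  induction m generalizing p with
  | zero =>
    obtain rfl := List.length_eq_zero_iff.1 hm
    refine ⟨[], fun v hv => ?_⟩
    cases v with
    | nil =>
      rw [List.rotate_nil]
      refine ⟨Walk.nil, by simp, by simp, by simp, fun σ hσ => ⟨[], by simp, 0, fun i s => ?_⟩⟩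
      simp only [List.take_nil, List.not_mem_nil, false_iff]
      intro h
      simpa using (hσ i s h).1
    | cons x u =>
      obtain ⟨W₀, h₀, hl₀, hs₀, hc₀⟩ := exists_rotation_path x u (List.Nodup.of_map _ hv)
      obtain ⟨W, h, hl, hs⟩ := h₀.exists_map (Hom.ofLE (adjSwapGraph_le_signedWordGraph ι))
        (fun _ _ h => h) (u' := x :: u) (v' := u ++ [x]) rfl rfl
      rw [List.rotate_cons_succ, List.rotate_zero]
      refine ⟨W, h, ?_, ?_, ?_⟩
      · simp only [List.length_nil, List.length_cons, pow_zero, mul_one]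
        omega
      · intro w hw
        obtain ⟨w, hw', rfl⟩ := (hs w).1 hw
        exact ⟨(hs₀ w hw').map _, fun a ha => (hs₀ w hw').symm.subset ha⟩
      · intro σ hσ
        obtain ⟨w, hw, k, hk⟩ := hc₀ {a | σ a.1 = some a.2}
          fun a ha => (hσ a.1 a.2 ha).2 (hσ a.1 a.2 ha).1
        exact ⟨w, (hs w).2 ⟨w, hw, rfl⟩, k, fun i s => hk (i, s)⟩
  | succ m ih =>
    obtain ⟨q, x, rfl⟩ : ∃ q x, p = q ++ [x] :=
      (List.eq_nil_or_concat' p).resolve_left (by rintro rfl; simp at hm)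
    rw [List.length_append, List.length_singleton, Nat.add_right_cancel_iff] at hm
    by_cases hqx : ((q ++ [x]).map Prod.fst).Nodup
    swap
    -- If an index repeats in `p`, no `v` is admissible, so the choice of `p'` is irrelevant.
    · refine ⟨[], fun v hv => absurd ?_ hqx⟩
      rw [List.map_append] at hv
      exact (List.nodup_append.1 hv).1
    obtain ⟨q', hq'⟩ := ih q hm
    have hperm : (q'.map Prod.fst).Perm (q.map Prod.fst) := by
      rw [List.map_append] at hqx
      -- For `v = []` the path ends in `q'` itself, so `q'` uses the same indices as `q`.
      obtain ⟨W, -, -, hs, -⟩ := hq' [] (by simpa using (List.nodup_append.1 hqx).1)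
      simpa using (hs _ W.end_mem_support).1
    have hlen : q'.length = q.length := by simpa using hperm.length_eq
    -- The second path starts where the first one left the free letters. Since `q'` is no part of
    -- `p`, the induction is on length. Neither `q'` nor `q''` depends on `v`, which later lets the
    -- cycle close.
    obtain ⟨q'', hq''⟩ := ih q' (hlen.trans hm)
    refine ⟨negLetter x :: q'', fun v hv => ?_⟩
    have hv₁ : ((q ++ x :: v).map Prod.fst).Nodup := by simpa using hv
    have hperm₂ : ((q' ++ v).map Prod.fst).Perm ((q ++ v).map Prod.fst) := by
      simpa using hperm.append_right _
    have hpermx : ((x :: (q' ++ v)).map Prod.fst).Perm ((q ++ [x] ++ v).map Prod.fst) := by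
      rw [List.map_cons]
      refine (hperm₂.cons x.1).trans ?_
      simpa using (List.perm_middle (a := x.1) (l₁ := q.map Prod.fst) (l₂ := v.map Prod.fst)).symm
    have hv₂ : ((x :: (q' ++ v)).map Prod.fst).Nodup := hpermx.nodup_iff.2 hv
    have hrot : ((v.rotate 1).map Prod.fst).Perm (v.map Prod.fst) := (v.rotate_perm 1).map _
    have H₁ := hq' (x :: v) hv₁
    rw [List.rotate_cons_succ, List.rotate_zero, ← List.append_assoc q' v [x],
      List.append_cons q x v] at H₁
    obtain ⟨W₁, h₁, hl₁, hs₁, hc₁⟩ := H₁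
    obtain ⟨W₂, h₂, hl₂, hs₂, hc₂⟩ := hq'' v (List.nodup_cons.1 hv₂).2
    have hB : ((q' ++ v ++ [x]).map Prod.fst).Nodup := by
      rw [List.map_append, List.map_singleton]
      exact (List.perm_append_singleton _ _).nodup_iff.2 hv₂
    obtain ⟨W, h, hl, hs, hW₁, hW₂⟩ := exists_turned_path hB h₁
      (fun w hw => ⟨(hs₁ w hw).1.nodup_iff.2 hv, (hs₁ w hw).2 x (by simp)⟩) h₂
    refine ⟨W, h, ?_, ?_, ?_⟩
    · simp only [List.length_append, List.length_cons, List.length_nil, hl, hlen, pow_succ] at *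
      -- The first summand counts the `σ` in which `x` is absent or has its own sign, the second
      -- those with its opposite sign.
      have h3 : 2 ^ v.length * (3 ^ q.length * 3) =
        2 ^ v.length * 2 * 3 ^ q.length + 2 ^ v.length * 3 ^ q.length := by ring
      omega
    · intro w hw
      rcases hs w hw with hw | ⟨a, b, hab, rfl⟩ | ⟨w, hw', rfl⟩
      · exact ⟨(hs₁ w hw).1, fun a ha => (hs₁ w hw).2 a (List.mem_cons_of_mem _ ha)⟩
      · refine ⟨((List.perm_middle.map _).trans ?_).trans hpermx, fun c hc => ?_⟩
        · rw [hab, List.map_cons, List.map_cons, negLetter_fst]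
        · refine List.perm_middle.symm.subset (List.mem_cons_of_mem _ ?_)
          rw [hab]
          exact List.mem_append_right _ hc
      · exact ⟨((hs₂ w hw').1.cons x.1).trans hpermx,
          fun c hc => List.mem_cons_of_mem _ ((hs₂ w hw').2 c hc)⟩
    · intro σ hσ
      by_cases hx : σ x.1 = some (-x.2)
      · obtain ⟨w, hw, hw'⟩ := hc₂ (Function.update σ x.1 none) fun i s his => by
          obtain ⟨g₁, g₂⟩ := hσ.update i s his
          exact ⟨hperm₂.symm.subset g₁, g₂⟩
        exact ⟨_, hW₂ w hw, IsPrefixSigns.cons (x := negLetter x) hx hw'⟩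
      · obtain ⟨w, hw, hw'⟩ := hc₁ σ (hσ.of_turn hx)
        exact ⟨w, hW₁ w hw, hw'⟩

/-- A cycle of signed words that runs through all prefix signs, with as few steps as possible. -/
lemma exists_signed_cycle {ι : Type*} [DecidableEq ι] (p : List (ι × ℤˣ)) (hp : p ≠ [])
    (x : ι × ℤˣ) (hpx : ((p ++ [x]).map Prod.fst).Nodup) :
    ∃ u, ∃ c : (signedWordGraph ι).Walk u u, c.IsCycle ∧ c.length + 1 = 3 ^ (p.length + 1) ∧
      (∀ w ∈ c.support, (w.map Prod.fst).Perm ((p ++ [x]).map Prod.fst)) ∧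
      ∀ σ, (∀ i, σ i ≠ none → i ∈ (p ++ [x]).map Prod.fst) →
        ∃ w ∈ c.support, IsPrefixSigns σ w := by
  have hpow : ∀ m, 2 * m + 1 ≤ 3 ^ m := fun m => by
    induction m with
    | zero => simp
    | succ m ih => rw [pow_succ]; omega
  obtain ⟨p', hp'⟩ := exists_signed_path p
  have hperm_px : ((x :: p).map Prod.fst).Perm ((p ++ [x]).map Prod.fst) :=
    (List.perm_append_singleton x p).symm.map _
  have hxp : ((x :: p).map Prod.fst).Nodup := hperm_px.nodup_iff.2 hpx
  have hx : negLetter x ∉ p := fun h =>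
    (List.nodup_cons.1 hxp).1 (List.mem_map.2 ⟨_, h, rfl⟩)
  have H₀ := hp' [] (by simpa using (List.nodup_cons.1 hxp).2)
  rw [List.rotate_nil, List.append_nil p, List.append_nil p'] at H₀
  simp only [List.length_nil, pow_zero, add_zero, one_mul] at H₀
  obtain ⟨W₀, h₀, hl₀, hs₀, hc₀⟩ := H₀
  have H₁ := hp' [x] hpx
  rw [List.rotate_singleton] at H₁
  obtain ⟨W₁, h₁, hl₁, hs₁, hc₁⟩ := H₁
  have hperm : (p'.map Prod.fst).Perm (p.map Prod.fst) := (hs₀ _ W₀.end_mem_support).1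
  have hlen : p'.length = p.length := by simpa using hperm.length_eq
  have hx' : negLetter x ∉ p' := fun h =>
    (List.nodup_cons.1 hxp).1 (hperm.subset (List.mem_map.2 ⟨_, h, rfl⟩))
  -- Equality would make the path `W₀` trivial, but its length is `3 ^ p.length - 1 - p.length`,
  -- which is positive.
  have hne : p ≠ p' := by
    rintro rfl
    rw [Walk.length_eq_zero_iff.2 (Walk.isPath_iff_nil.1 h₀)] at hl₀
    have := hpow p.length
    have := List.length_pos_iff.2 hp
    omega
  have hpp' : ((p' ++ [x]).map Prod.fst).Nodup :=
    ((hs₁ _ W₁.end_mem_support).1).nodup_iff.2 hpx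
  -- Both `W₀` and `W₁` arrive at the same `p'`, so after `x` is turned, `W₀` can be run backwards
  -- behind it to return to `p`. Moving the turned letter to the end and turning it again then
  -- closes the cycle.
  obtain ⟨W, h, hl, hs, hW₁, hW₂⟩ := exists_turned_path hpp' h₁
    (fun w hw => ⟨(hs₁ w hw).1.nodup_iff.2 hpx, (hs₁ w hw).2 x (by simp)⟩) h₀.reverse
  obtain ⟨U', hU', hUl', hUs'⟩ := exists_ascending_path (negLetter x) p hx
  obtain ⟨U, hU, hUl, hUs⟩ := hU'.exists_map (Hom.ofLE (adjSwapGraph_le_signedWordGraph ι))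
    (fun _ _ h => h) (u' := negLetter x :: p) (v' := p ++ [negLetter x]) rfl rfl
  have hUs : ∀ w ∈ U.support, ∃ a b, a ++ b = p ∧ w = a ++ negLetter x :: b := fun w hw => by
    obtain ⟨w, hw', rfl⟩ := (hUs w).1 hw
    exact hUs' w hw'
  have herase : ∀ a b : List (ι × ℤˣ), negLetter x ∉ a ++ b →
      (a ++ negLetter x :: b).erase (negLetter x) = a ++ b := fun a b hab => by
    rw [List.erase_append_right _ fun h => hab (List.mem_append_left _ h), List.erase_cons_head]
  have hWU : (W.append U).IsPath := by
    refine h.append_of_inter hU fun w hw hw' => ?_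
    obtain ⟨a, b, hab, rfl⟩ := hUs w hw'
    rcases hs _ hw with hw | ⟨a', b', hab', h⟩ | ⟨w₀, hw₀, h⟩
    · refine absurd ?_ (negLetter_ne x)
      exact eq_of_fst_eq_of_nodup ((hs₁ _ hw).1.nodup_iff.2 hpx) (by simp)
        ((hs₁ _ hw).2 x (by simp)) rfl
    -- A word common to the descent and the final ascent would give both `p` and `p'` on deleting
    -- the turned letter.
    · have := congrArg (List.erase · (negLetter x)) h
      rw [herase _ _ (hab ▸ hx), herase _ _ (hab' ▸ hx'), hab, hab'] at this
      exact absurd this hne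
    · cases a with
      | nil =>
        rw [List.nil_append] at hab
        simp [hab]
      | cons y a =>
        simp only [List.cons_append, List.cons.injEq] at h
        exact absurd (hab ▸ by simp [h.1]) hx
  have hadj : (signedWordGraph ι).Adj (p ++ [negLetter x]) (p ++ [x]) :=
    Or.inr ⟨p, negLetter x, rfl, by simp⟩
  have hlength : (Walk.cons hadj (W.append U)).length + 1 = 3 ^ (p.length + 1) := by
    simp only [Walk.length_cons, Walk.length_append, hl, hUl, hUl', Walk.length_reverse, hlen,
      List.length_singleton, pow_succ, pow_zero] at *
    omega
  have hends : ∀ a b, a ++ b = p ∨ a ++ b = p' →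
      ((a ++ negLetter x :: b).map Prod.fst).Perm ((p ++ [x]).map Prod.fst) := fun a b hab => by
    refine ((List.perm_middle.map _).trans ?_).trans hperm_px
    rw [List.map_cons, List.map_cons, negLetter_fst]
    rcases hab with hab | hab
    · rw [hab]
    · rw [hab]
      exact hperm.cons _
  refine ⟨_, Walk.cons hadj (W.append U), ?_, hlength, ?_, ?_⟩
  · rw [Walk.isCycle_iff_isPath_tail_and_le_length]
    refine ⟨by simpa using hWU, ?_⟩
    have := hpow (p.length + 1)
    have := List.length_pos_iff.2 hp
    have : 3 ^ 2 ≤ 3 ^ (p.length + 1) := Nat.pow_le_pow_right (by simp) (by omega)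
    omega
  · intro w hw
    rw [Walk.support_cons, List.mem_cons, Walk.mem_support_append_iff] at hw
    rcases hw with rfl | hw | hw
    · exact hends p [] (by simp)
    · rcases hs w hw with hw | ⟨a, b, hab, rfl⟩ | ⟨w, hw', rfl⟩
      · exact (hs₁ w hw).1
      · exact hends a b (Or.inr hab)
      · rw [Walk.support_reverse, List.mem_reverse] at hw'
        exact ((hs₀ w hw').1.cons x.1).trans hperm_px
    · obtain ⟨a, b, hab, rfl⟩ := hUs w hw
      exact hends a b (Or.inl hab)
  · intro σ hσ
    have hσ' : IsCompatible (p ++ [x]) [] σ := fun i s his =>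
      ⟨by simpa using hσ i (by simp [his]), by simp⟩
    by_cases hσx : σ x.1 = some (-x.2)
    · obtain ⟨w, hw, hw'⟩ := hc₀ _ hσ'.update
      refine ⟨negLetter x :: w, ?_, IsPrefixSigns.cons (x := negLetter x) hσx hw'⟩
      rw [Walk.support_cons, List.mem_cons, Walk.mem_support_append_iff]
      exact Or.inr (Or.inl (hW₂ w (by simpa using hw)))
    · obtain ⟨w, hw, hw'⟩ := hc₁ σ (hσ'.of_turn hσx)
      refine ⟨w, ?_, hw'⟩
      rw [Walk.support_cons, List.mem_cons, Walk.mem_support_append_iff]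
      exact Or.inr (Or.inl (hW₁ w hw))

/-! ### Counting the entries of a closed walk -/

/-- In one step between signed words at most one new set of prefix signs occurs. -/
lemma IsPrefixSigns.eq_of_adj {ι : Type*} {w w' : List (ι × ℤˣ)}
    (h : (signedWordGraph ι).Adj w w') {σ τ : ι → Option ℤˣ} (hσ : ¬ IsPrefixSigns σ w)
    (hσ' : IsPrefixSigns σ w') (hτ : ¬ IsPrefixSigns τ w) (hτ' : IsPrefixSigns τ w') : σ = τ := by
  obtain ⟨k, hk⟩ : ∃ k, ∀ ρ : ι → Option ℤˣ, ¬ IsPrefixSigns ρ w → IsPrefixSigns ρ w' →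
      ∀ i s, (i, s) ∈ w'.take k ↔ ρ i = some s := by
    rcases h with ⟨a, x, y, b, -, rfl, rfl⟩ | ⟨a, x, rfl, rfl⟩
    -- Only the prefix ending between the exchanged letters changes as a set.
    · refine ⟨a.length + 1, fun ρ hρ ⟨k, hk⟩ => ?_⟩
      rcases lt_trichotomy k (a.length + 1) with hlt | rfl | hgt
      · refine absurd ⟨k, ?_⟩ hρ
        rwa [List.take_append_of_le_length (by omega)] at hk ⊢
      · exact hk
      · obtain ⟨m, rfl⟩ : ∃ m, k = a.length + (m + 1 + 1) := ⟨k - (a.length + 2), by omega⟩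
        refine absurd ⟨a.length + (m + 1 + 1), fun i s => (Iff.trans ?_ (hk i s))⟩ hρ
        simp only [List.take_length_add_append, List.take_succ_cons, List.mem_append, List.mem_cons]
        tauto
    -- Only the whole word changes as a set; any larger `k` also takes the whole word.
    · refine ⟨a.length + 1, fun ρ hρ ⟨k, hk⟩ => ?_⟩
      rcases lt_or_ge k (a.length + 1) with hlt | hge
      · refine absurd ⟨k, ?_⟩ hρ
        rwa [List.take_append_of_le_length (by omega)] at hk ⊢
      · rw [List.take_of_length_le (by simpa using hge)] at hk
        rwa [List.take_of_length_le (by simp)]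
  funext i
  exact Option.ext fun s => (hk σ hσ hσ' i s).symm.trans (hk τ hτ hτ' i s)

/-- Around a closed walk, a property of vertices that holds somewhere but not everywhere changes
from false to true somewhere. -/
lemma SimpleGraph.Walk.exists_entry {V : Type*} {G : SimpleGraph V} {v : V} (c : G.Walk v v)
    (Q : V → Prop) {x y : V} (hx : x ∈ c.support) (hQx : Q x) (hy : y ∈ c.support) (hQy : ¬ Q y) :
    ∃ t < c.length, ¬ Q (c.getVert t) ∧ Q (c.getVert (t + 1)) := by
  by_contra! h
  have key : ∀ s, ¬ Q (c.getVert s) → ∀ m, s + m ≤ c.length → ¬ Q (c.getVert (s + m)) := by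
    intro s hs m
    induction m with
    | zero => exact fun _ => hs
    | succ m ih => exact fun hm => h (s + m) (by omega) (ih (by omega))
  obtain ⟨i, rfl, hi⟩ := c.mem_support_iff_exists_getVert.1 hx
  obtain ⟨j, rfl, hj⟩ := c.mem_support_iff_exists_getVert.1 hy
  have hend : ¬ Q v := by
    have := key j hQy (c.length - j) (by omega)
    rwa [Nat.add_sub_cancel' hj, Walk.getVert_length] at this
  have := key 0 (by rwa [Walk.getVert_zero]) i (by omega)
  rw [zero_add] at this
  exact this hQx

/-- If a property of vertices changes from false to true only once around a closed walk, then the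
part of the walk with this property is connected. -/
lemma SimpleGraph.Walk.connected_inf_induce_of_unique_entry {V : Type*} {G : SimpleGraph V} {v : V}
    (c : G.Walk v v) (Q : V → Prop)
    (h : ∃ t < c.length, ¬ Q (c.getVert t) ∧ Q (c.getVert (t + 1)))
    (huniq : ∀ s < c.length, ∀ t < c.length, ¬ Q (c.getVert s) → Q (c.getVert (s + 1)) →
      ¬ Q (c.getVert t) → Q (c.getVert (t + 1)) → s = t) :
    (c.toSubgraph ⊓ (⊤ : G.Subgraph).induce {v | Q v}).Connected := by
  obtain ⟨t₀, ht₀, hn, hQ⟩ := h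
  set H := c.toSubgraph ⊓ (⊤ : G.Subgraph).induce {v | Q v}
  have hmem : ∀ {s}, Q (c.getVert s) → c.getVert s ∈ H.verts := fun {s} hs =>
    ⟨(c.mem_verts_toSubgraph).2 (c.getVert_mem_support s), hs⟩
  have hadj : ∀ {s}, s < c.length → Q (c.getVert s) → Q (c.getVert (s + 1)) →
      H.Adj (c.getVert s) (c.getVert (s + 1)) := fun {s} hs h₁ h₂ =>
    ⟨c.toSubgraph_adj_getVert hs, h₁, h₂, c.adj_getVert_succ hs⟩
  have hreach_up : ∀ m, ∀ (hm : Q (c.getVert (t₀ + 1 + m))), t₀ + 1 + m ≤ c.length →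
      H.coe.Reachable ⟨_, hmem hQ⟩ ⟨_, hmem hm⟩ := by
    intro m
    induction m with
    | zero => exact fun _ _ => Reachable.refl _
    | succ m ih =>
      intro hm hle
      by_cases hm' : Q (c.getVert (t₀ + 1 + m))
      · exact (ih hm' (by omega)).trans (Adj.reachable (hadj (by omega) hm' hm))
      · have := huniq _ (by omega) _ ht₀ hm' hm hn hQ
        omega
  have hreach_low : ∀ m, ∀ (hm : Q (c.getVert m)), m ≤ t₀ →
      H.coe.Reachable ⟨_, hmem hQ⟩ ⟨_, hmem hm⟩ := by
    intro m
    induction m with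
    | zero =>
      intro hm _
      -- The arc beginning at `t₀ + 1` may pass the base point: indices `0` and `c.length` give the
      -- same vertex.
      have hv : Q (c.getVert (t₀ + 1 + (c.length - (t₀ + 1)))) := by
        rw [Nat.add_sub_cancel' (by omega), Walk.getVert_length]
        rwa [Walk.getVert_zero] at hm
      convert hreach_up (c.length - (t₀ + 1)) hv (by omega) using 2
      rw [Nat.add_sub_cancel' (by omega), Walk.getVert_length, Walk.getVert_zero]
    | succ m ih =>
      intro hm hle
      by_cases hm' : Q (c.getVert m)
      · exact (ih hm' (by omega)).trans (Adj.reachable (hadj (by omega) hm' hm))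
      · have := huniq _ (by omega) _ ht₀ hm' hm hn hQ
        omega
  have hreach : ∀ x : H.verts, H.coe.Reachable ⟨_, hmem hQ⟩ x := by
    rintro ⟨x, hx⟩
    obtain ⟨s, rfl, hs⟩ := c.mem_support_iff_exists_getVert.1 ((c.mem_verts_toSubgraph).1 hx.1)
    rcases le_or_gt s t₀ with hle | hgt
    · exact hreach_low s hx.2 hle
    · obtain ⟨m, rfl⟩ := Nat.exists_eq_add_of_lt hgt
      have hm : t₀ + m + 1 = t₀ + 1 + m := by omega
      simp only [hm] at hx ⊢
      exact hreach_up m hx.2 (hm ▸ hs)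
  rw [Subgraph.connected_iff']
  exact (connected_iff _).2 ⟨fun x y => (hreach x).symm.trans (hreach y), ⟨⟨_, hmem hQ⟩⟩⟩

/-- If a closed walk of signed words has only as many steps as there are nonempty sets of prefix
signs, and all of them occur, then each of them is entered only once. -/
lemma entry_unique {ι : Type*} [Fintype ι] [DecidableEq ι] {u : List (ι × ℤˣ)}
    (c : (signedWordGraph ι).Walk u u) (hlen : c.length + 1 = 3 ^ Fintype.card ι)
    (hc : ∀ σ : ι → Option ℤˣ, σ ≠ (fun _ => none) →
      ∃ t < c.length, ¬ IsPrefixSigns σ (c.getVert t) ∧ IsPrefixSigns σ (c.getVert (t + 1)))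
    {σ : ι → Option ℤˣ} {s t : ℕ} (hs : s < c.length) (ht : t < c.length)
    (hs₁ : ¬ IsPrefixSigns σ (c.getVert s)) (hs₂ : IsPrefixSigns σ (c.getVert (s + 1)))
    (ht₁ : ¬ IsPrefixSigns σ (c.getVert t)) (ht₂ : IsPrefixSigns σ (c.getVert (t + 1))) :
    s = t := by
  choose! f hf hf₁ hf₂ using hc
  -- Choosing an entry step for each `σ` is injective, since a step enters at most one `σ`. The
  -- cardinalities agree, so every step is the chosen entry of some `τ`, which leaves no room for a
  -- second entry.
  let g : {σ : ι → Option ℤˣ // σ ≠ fun _ => none} → Fin c.length := fun σ => ⟨f σ, hf σ σ.2⟩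
  have hg : Function.Injective g := fun σ τ h => by
    have h : f σ = f τ := congrArg Fin.val h
    refine Subtype.ext (IsPrefixSigns.eq_of_adj (c.adj_getVert_succ (hf σ σ.2)) (hf₁ _ σ.2)
      (hf₂ _ σ.2) ?_ ?_)
    · exact h ▸ hf₁ _ τ.2
    · exact h ▸ hf₂ _ τ.2
  have hcard : Fintype.card {σ : ι → Option ℤˣ // σ ≠ fun _ => none} =
      Fintype.card (Fin c.length) := by
    rw [Fintype.card_subtype_compl, Fintype.card_subtype_eq, Fintype.card_fun, Fintype.card_option,
      Fintype.card_units_int, Fintype.card_fin, ← hlen, Nat.add_sub_cancel]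
  have hsurj : ∀ r < c.length, ¬ IsPrefixSigns σ (c.getVert r) →
      IsPrefixSigns σ (c.getVert (r + 1)) → r = f σ := by
    intro r hr h₁ h₂
    obtain ⟨τ, hτ⟩ := ((Fintype.bijective_iff_injective_and_card g).2 ⟨hg, hcard⟩).2 ⟨r, hr⟩
    obtain rfl : f τ = r := congrArg Fin.val hτ
    rw [IsPrefixSigns.eq_of_adj (c.adj_getVert_succ hr) h₁ h₂ (hf₁ _ τ.2) (hf₂ _ τ.2)]
  rw [hsurj s hs hs₁ hs₂, hsurj t ht ht₁ ht₂]

/-! ### Signed permutations maximizing a linear functional -/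

/-- The set of all signed permutations of `{1, …, n}`. -/
def signedPerms (n : ℕ) : Set (Fin n → ℝ) :=
  {x | ∃ (π : Equiv.Perm (Fin n)) (ε : Fin n → ℤˣ), x = signedPermPoint π ε}

lemma abs_units_cast (s : ℤˣ) : |((s : ℤ) : ℝ)| = 1 := by
  rcases Int.units_eq_one_or s with rfl | rfl <;> simp

lemma abs_signedPermPoint {n : ℕ} (π : Equiv.Perm (Fin n)) (ε : Fin n → ℤˣ) (i : Fin n) :
    |signedPermPoint π ε i| = (π i : ℕ) + 1 := by
  rw [signedPermPoint, abs_mul, abs_units_cast, one_mul, abs_of_nonneg (by positivity)]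

lemma exists_perm_of_mem_signedPerms {n : ℕ} {x : Fin n → ℝ} (hx : x ∈ signedPerms n) :
    ∃ π : Equiv.Perm (Fin n), ∀ i, |x i| = (π i : ℕ) + 1 := by
  obtain ⟨π, ε, rfl⟩ := hx
  exact ⟨π, abs_signedPermPoint π ε⟩

/-- Membership depends only on the absolute values, so sign changes and exchanges of coordinates can
be checked without constructing `π` and `ε`. -/
lemma mem_signedPerms_iff {n : ℕ} {x : Fin n → ℝ} :
    x ∈ signedPerms n ↔
      (∀ i, ∃ m < n, |x i| = (m : ℝ) + 1) ∧ Function.Injective fun i => |x i| := by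
  constructor
  · intro hx
    obtain ⟨π, hπ⟩ := exists_perm_of_mem_signedPerms hx
    refine ⟨fun i => ⟨π i, (π i).2, hπ i⟩, fun i j hij => π.injective (Fin.ext ?_)⟩
    simp only [hπ, add_left_inj, Nat.cast_inj] at hij
    exact hij
  · rintro ⟨h, hinj⟩
    choose m hm hxm using h
    have hf : Function.Injective fun i => (⟨m i, hm i⟩ : Fin n) := fun i j hij => hinj (by
      simp only [hxm, Fin.mk.inj_iff.1 hij])
    refine ⟨Equiv.ofBijective _ (Finite.injective_iff_bijective.1 hf),
      fun i => if 0 ≤ x i then 1 else -1, funext fun i => ?_⟩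
    simp only [signedPermPoint, Equiv.ofBijective_apply, ← hxm]
    split_ifs with h
    · simp [abs_of_nonneg h]
    · simp [abs_of_neg (not_le.1 h)]

lemma finite_signedPerms (n : ℕ) : (signedPerms n).Finite := by
  refine (Set.finite_range fun p : Equiv.Perm (Fin n) × (Fin n → ℤˣ) =>
    signedPermPoint p.1 p.2).subset ?_
  rintro _ ⟨π, ε, rfl⟩
  exact ⟨(π, ε), rfl⟩

lemma one_le_abs_of_mem_signedPerms {n : ℕ} {x : Fin n → ℝ} (hx : x ∈ signedPerms n) (i : Fin n) :
    1 ≤ |x i| := by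
  obtain ⟨m, -, h⟩ := (mem_signedPerms_iff.1 hx).1 i
  rw [h]
  linarith [m.cast_nonneg (α := ℝ)]

lemma ne_zero_of_mem_signedPerms {n : ℕ} {x : Fin n → ℝ} (hx : x ∈ signedPerms n) (i : Fin n) :
    x i ≠ 0 := fun h => by
  have := one_le_abs_of_mem_signedPerms hx i
  rw [h, abs_zero] at this
  linarith

lemma dotProduct_self_eq_of_mem_signedPerms {n : ℕ} {x y : Fin n → ℝ} (hx : x ∈ signedPerms n)
    (hy : y ∈ signedPerms n) : x ⬝ᵥ x = y ⬝ᵥ y := by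
  have key : ∀ z ∈ signedPerms n, z ⬝ᵥ z = ∑ k : Fin n, (((k : ℕ) : ℝ) + 1) ^ 2 := by
    intro z hz
    obtain ⟨π, hπ⟩ := exists_perm_of_mem_signedPerms hz
    rw [← Equiv.sum_comp π, dotProduct]
    exact Finset.sum_congr rfl fun i _ => by rw [← hπ, sq_abs, sq]
  rw [key x hx, key y hy]

/-- The linear functional with coefficient vector `c`. -/
noncomputable def dotFunctional {n : ℕ} (c : Fin n → ℝ) : StrongDual ℝ (Fin n → ℝ) :=
  ∑ i, c i • ContinuousLinearMap.proj i

@[simp] lemma dotFunctional_apply {n : ℕ} (c x : Fin n → ℝ) : dotFunctional c x = c ⬝ᵥ x := by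
  simp [dotFunctional, dotProduct]

lemma strongDual_eq_dotProduct {n : ℕ} (l : StrongDual ℝ (Fin n → ℝ)) (x : Fin n → ℝ) :
    l x = (fun i => l (Pi.single i 1)) ⬝ᵥ x := by
  conv_lhs => rw [pi_eq_sum_univ' x]
  simp [dotProduct, mul_comm]

/-- A linear functional attains its maximum over a convex hull only in convex sets that contain all
the generators at which it attains its maximum. -/
lemma le_and_mem_of_mem_convexHull {E : Type*} [AddCommGroup E] [Module ℝ E] {V K : Set E}
    (hK : Convex ℝ K) {l : E → ℝ} (hl : IsLinearMap ℝ l) {L : ℝ}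
    (h : ∀ v ∈ V, l v ≤ L ∧ (l v = L → v ∈ K)) {x : E} (hx : x ∈ convexHull ℝ V) :
    l x ≤ L ∧ (l x = L → x ∈ K) := by
  refine convexHull_min (t := {x | l x ≤ L ∧ (l x = L → x ∈ K)}) h ?_ hx
  rw [convex_iff_forall_pos]
  rintro y ⟨hy, hy'⟩ z ⟨hz, hz'⟩ a b ha hb hab
  simp only [Set.mem_ofPred_eq, hl.map_add, hl.map_smul, smul_eq_mul]
  have h1 : a * l y ≤ a * L := by gcongr
  have h2 : b * l z ≤ b * L := by gcongr
  have h3 : a * L + b * L = L := by rw [← add_mul, hab, one_mul]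
  refine ⟨by linarith, fun h => hK (hy' ?_) (hz' ?_) ha.le hb.le hab⟩
  · exact mul_left_cancel₀ ha.ne' (by linarith)
  · exact mul_left_cancel₀ hb.ne' (by linarith)

lemma update_neg_mem_signedPerms {n : ℕ} {x : Fin n → ℝ} (hx : x ∈ signedPerms n) (i : Fin n) :
    x + Pi.single i (-2 * x i) ∈ signedPerms n := by
  have habs : ∀ k, |(x + Pi.single i (-2 * x i) : Fin n → ℝ) k| = |x k| := fun k => by
    by_cases hk : k = i
    · subst hk
      rw [Pi.add_apply, Pi.single_eq_same, ← abs_neg]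
      congr 1
      ring
    · simp [hk]
  rw [mem_signedPerms_iff] at hx ⊢
  simpa only [habs] using hx

section Exchange

variable {n : ℕ} {c x : Fin n → ℝ}

/-- A signed permutation that maximizes a linear functional has the signs of its coefficients. -/
lemma mul_pos_of_maximizes (hx : x ∈ signedPerms n)
    (hmax : ∀ y ∈ signedPerms n, c ⬝ᵥ y ≤ c ⬝ᵥ x) {i : Fin n} (hi : c i ≠ 0) : 0 < c i * x i := by
  have h := hmax _ (update_neg_mem_signedPerms hx i)
  rw [dotProduct_add, dotProduct_single] at h
  exact lt_of_le_of_ne (by linarith) (mul_ne_zero hi (ne_zero_of_mem_signedPerms hx i)).symm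

/-- The absolute values of a signed permutation that maximizes a linear functional are ordered as
those of its coefficients. -/
lemma abs_lt_abs_of_maximizes (hx : x ∈ signedPerms n)
    (hmax : ∀ y ∈ signedPerms n, c ⬝ᵥ y ≤ c ⬝ᵥ x) {i j : Fin n} (hij : |c i| < |c j|) :
    |x i| < |x j| := by
  have hne : i ≠ j := by rintro rfl; exact lt_irrefl _ hij
  have hsgn : ∀ k, c k * x k = |c k| * |x k| := fun k => by
    by_cases hk : c k = 0
    · simp [hk]
    · rw [← abs_mul, abs_of_pos (mul_pos_of_maximizes hx hmax hk)]
  have hexists : ∀ a b : ℝ, ∃ p, |p| = |b| ∧ a * p = |a| * |b| := fun a b => by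
    rcases le_or_gt 0 a with ha | ha
    · exact ⟨|b|, by simp, by rw [abs_of_nonneg ha]⟩
    · exact ⟨-|b|, by simp, by rw [abs_of_neg ha]; ring⟩
  -- The competitor exchanges the absolute values at `i` and `j`, with signs matched to `c`. It
  -- changes the value of the functional by `(|c j| - |c i|) * (|x i| - |x j|)`.
  obtain ⟨p, hp, hp'⟩ := hexists (c i) (x j)
  obtain ⟨q, hq, hq'⟩ := hexists (c j) (x i)
  have hy : x + Pi.single i (p - x i) + Pi.single j (q - x j) ∈ signedPerms n := by
    have habs : ∀ k, |(x + Pi.single i (p - x i) + Pi.single j (q - x j) : Fin n → ℝ) k| =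
        |x (Equiv.swap i j k)| := fun k => by
      by_cases hki : k = i
      · subst hki; simp [hne, hp]
      · by_cases hkj : k = j
        · subst hkj; simp [hki, hq]
        · simp [hki, hkj, Equiv.swap_apply_of_ne_of_ne]
    rw [mem_signedPerms_iff] at hx ⊢
    simp only [habs]
    exact ⟨fun k => hx.1 _, hx.2.comp (Equiv.swap i j).injective⟩
  have h := hmax _ hy
  rw [dotProduct_add, dotProduct_add, dotProduct_single, dotProduct_single, mul_sub, mul_sub, hp',
    hq', hsgn, hsgn] at h
  have hle : |x i| ≤ |x j| := by
    by_contra! hlt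
    nlinarith [mul_pos (sub_pos.2 hij) (sub_pos.2 hlt)]
  exact lt_of_le_of_ne hle fun h => hne ((mem_signedPerms_iff.1 hx).2 h)

end Exchange

/-- Signed permutations whose absolute values are ordered in the same way have the same absolute
values. -/
lemma abs_eq_abs_of_order {n : ℕ} {x u : Fin n → ℝ} (hx : x ∈ signedPerms n)
    (hu : u ∈ signedPerms n) (h : ∀ i j, |u i| < |u j| → |x i| < |x j|) (i : Fin n) :
    |x i| = |u i| := by
  obtain ⟨π, hπ⟩ := exists_perm_of_mem_signedPerms hx
  obtain ⟨ρ, hρ⟩ := exists_perm_of_mem_signedPerms hu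
  have hmono : StrictMono (ρ.symm.trans π) := fun a b hab => by
    have := h (ρ.symm a) (ρ.symm b)
    simpa [hπ, hρ, hab] using this
  -- The only order automorphism of `Fin n` is the identity.
  have heq : hmono.orderIsoOfSurjective _ (Equiv.surjective _) = OrderIso.refl _ :=
    Subsingleton.elim _ _
  have := congrArg (fun e => e (ρ i)) heq
  simp only [StrictMono.coe_orderIsoOfSurjective, Equiv.trans_apply, Equiv.symm_apply_apply,
    OrderIso.refl_apply] at this
  rw [hπ, hρ, this]

lemma eq_of_abs_eq_of_mul_pos {a b c : ℝ} (h : |a| = |b|) (ha : 0 < c * a) (hb : 0 < c * b) :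
    a = b := by
  rcases abs_eq_abs.1 h with h | h
  · exact h
  · rw [h] at ha
    linarith

/-! ### Vertices and edges of the polytope -/

/-- All signed permutations lie on one sphere about the origin, so the functional with coefficient
vector `u` attains its maximum among them only at `u`. -/
lemma mem_exposedPoints_of_mem_signedPerms {n : ℕ} {u : Fin n → ℝ} (hu : u ∈ signedPerms n) :
    u ∈ (BPermutahedron n).exposedPoints ℝ := by
  refine ⟨subset_convexHull ℝ _ hu, dotFunctional u, fun y hy => ?_⟩
  have := le_and_mem_of_mem_convexHull (convex_singleton u) (l := dotFunctional u)
    (dotFunctional u).toLinearMap.isLinear (L := u ⬝ᵥ u) (V := signedPerms n) (fun v hv => ?_) hy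
  · rw [dotFunctional_apply u u]
    exact ⟨this.1, fun h => this.2 (le_antisymm this.1 h)⟩
  · have h0 : 0 ≤ (u - v) ⬝ᵥ (u - v) := Finset.sum_nonneg fun i _ => mul_self_nonneg _
    have h1 : (u - v) ⬝ᵥ (u - v) = 2 * (u ⬝ᵥ u - u ⬝ᵥ v) := by
      rw [sub_dotProduct, dotProduct_sub, dotProduct_sub, dotProduct_comm v u,
        dotProduct_self_eq_of_mem_signedPerms hv hu]
      ring
    rw [dotFunctional_apply]
    refine ⟨by linarith, fun h => ?_⟩
    rw [h, sub_self, mul_zero, dotProduct_self_eq_zero, sub_eq_zero] at h1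
    exact h1.symm

/-- On the common sphere, `u` and `v` give `u + v` the same value. Once every maximizing generator
is `u` or `v`, both therefore maximize, and they span the face. -/
lemma isExposed_segment_of_maximizers {n : ℕ} {u v : Fin n → ℝ} (hu : u ∈ signedPerms n)
    (hv : v ∈ signedPerms n)
    (h : ∀ x ∈ signedPerms n, (∀ y ∈ signedPerms n, (u + v) ⬝ᵥ y ≤ (u + v) ⬝ᵥ x) → x = u ∨ x = v) :
    IsExposed ℝ (BPermutahedron n) (segment ℝ u v) := by
  refine fun _ => ⟨dotFunctional (u + v), ?_⟩
  have hlin : IsLinearMap ℝ (dotFunctional (u + v)) := (dotFunctional (u + v)).toLinearMap.isLinear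
  have huv : (u + v) ⬝ᵥ v = (u + v) ⬝ᵥ u := by
    rw [add_dotProduct, add_dotProduct, dotProduct_comm v u,
      dotProduct_self_eq_of_mem_signedPerms hv hu, add_comm]
  have hmax : ∀ y ∈ signedPerms n, (u + v) ⬝ᵥ y ≤ (u + v) ⬝ᵥ u := by
    obtain ⟨x, hx, hmax⟩ := (finite_signedPerms n).exists_maximalFor (fun y => (u + v) ⬝ᵥ y) _
      ⟨u, hu⟩
    have hmax : ∀ y ∈ signedPerms n, (u + v) ⬝ᵥ y ≤ (u + v) ⬝ᵥ x := fun y hy =>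
      (le_total _ _).elim id (hmax hy)
    rcases h x hx hmax with rfl | rfl
    · exact hmax
    · exact fun y hy => huv ▸ hmax y hy
  have hP := fun x (hx : x ∈ BPermutahedron n) =>
    le_and_mem_of_mem_convexHull (convex_segment u v) hlin (L := (u + v) ⬝ᵥ u)
      (V := signedPerms n) (fun x hx => by
        rw [dotFunctional_apply]
        refine ⟨hmax x hx, fun hxL => ?_⟩
        rcases h x hx (fun y hy => hxL ▸ hmax y hy) with rfl | rfl
        · exact left_mem_segment ℝ _ _
        · exact right_mem_segment ℝ _ _) hx
  have huP : u ∈ BPermutahedron n := subset_convexHull ℝ _ hu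
  have hvP : v ∈ BPermutahedron n := subset_convexHull ℝ _ hv
  ext x
  constructor
  · intro hx
    refine ⟨(convex_convexHull ℝ _).segment_subset huP hvP hx, fun y hy => ?_⟩
    obtain ⟨a, b, -, -, hab, rfl⟩ := hx
    rw [dotFunctional_apply _ (_ + _), dotProduct_add, dotProduct_smul, dotProduct_smul, huv,
      ← add_smul, hab, one_smul]
    exact (hP y hy).1
  · rintro ⟨hx, hxmax⟩
    refine (hP x hx).2 (le_antisymm (hP x hx).1 ?_)
    have := hxmax u huP
    rwa [dotFunctional_apply _ u] at this

lemma abs_add_self (a : ℝ) : |a + a| = 2 * |a| := by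
  rw [← two_mul, abs_mul, abs_two]

/-- Changing the sign of the coordinate `± 1` gives an edge of the polytope. -/
lemma isExposed_segment_of_neg {n : ℕ} {u v : Fin n → ℝ} (hu : u ∈ signedPerms n)
    (hv : v ∈ signedPerms n) {i : Fin n} (hi : |u i| = 1) (hvi : v i = -u i)
    (hv' : ∀ k, k ≠ i → v k = u k) : IsExposed ℝ (BPermutahedron n) (segment ℝ u v) := by
  refine isExposed_segment_of_maximizers hu hv fun x hx hmax => ?_
  have hc : ∀ k, k ≠ i → (u + v) k = u k + u k := fun k hk => by rw [Pi.add_apply, hv' k hk]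
  have hci : (u + v) i = 0 := by simp [hvi]
  -- The coefficient is zero at `i`, where `|u|` is smallest, and twice that of `u` elsewhere. The
  -- order of absolute values is thus forced, and only the sign at `i` stays free.
  have habs : ∀ k, |x k| = |u k| := by
    refine abs_eq_abs_of_order hx hu fun a b hab => abs_lt_abs_of_maximizes hx hmax ?_
    have ha := one_le_abs_of_mem_signedPerms hu a
    have hb : b ≠ i := by rintro rfl; linarith
    rw [hc b hb, abs_add_self]
    by_cases hai : a = i
    · subst hai
      rw [hci, abs_zero]
      linarith
    · rw [hc a hai, abs_add_self]
      linarith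
  have hne : ∀ k, k ≠ i → x k = u k := fun k hk => by
    have h0 := ne_zero_of_mem_signedPerms hu k
    refine eq_of_abs_eq_of_mul_pos (habs k) (mul_pos_of_maximizes hx hmax (i := k) ?_) ?_
    · rw [hc k hk]
      exact fun h => h0 (by linarith)
    · rw [hc k hk, add_mul, ← two_mul]
      exact mul_pos two_pos (mul_self_pos.2 h0)
  rcases abs_eq_abs.1 (habs i) with h | h
  · left
    ext k
    by_cases hk : k = i
    · rw [hk, h]
    · exact hne k hk
  · right
    ext k
    by_cases hk : k = i
    · rw [hk, h, hvi]
    · rw [hne k hk, hv' k hk]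

lemma lt_add_one_iff_abs_le {n : ℕ} {x : Fin n → ℝ} (hx : x ∈ signedPerms n) (k : Fin n) (m : ℕ) :
    |x k| < (m : ℝ) + 1 ↔ |x k| ≤ m := by
  obtain ⟨r, -, hr⟩ := (mem_signedPerms_iff.1 hx).1 k
  rw [hr]
  exact_mod_cast Nat.lt_succ_iff

/-- The maximizers over an edge of exchange type. -/
lemma eq_of_maximizes_add {n m : ℕ} {u v x : Fin n → ℝ} (hu : u ∈ signedPerms n)
    (hx : x ∈ signedPerms n) {i j : Fin n} (hij : i ≠ j) (hm : 0 < m) {s t : ℤˣ}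
    (hui : u i = (s : ℤ) * (m + 1 : ℝ)) (huj : u j = (t : ℤ) * (m : ℝ))
    (hvi : v i = (s : ℤ) * (m : ℝ)) (hvj : v j = (t : ℤ) * (m + 1 : ℝ))
    (hv' : ∀ k, k ≠ i → k ≠ j → v k = u k)
    (hmax : ∀ y ∈ signedPerms n, (u + v) ⬝ᵥ y ≤ (u + v) ⬝ᵥ x) (hlt : |x j| < |x i|) : x = u := by
  have hm' : (0 : ℝ) < m := by exact_mod_cast hm
  have hui' : |u i| = m + 1 := by
    rw [hui, abs_mul, abs_units_cast, one_mul, abs_of_nonneg (by positivity)]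
  have huj' : |u j| = m := by
    rw [huj, abs_mul, abs_units_cast, one_mul, abs_of_nonneg (by positivity)]
  have hci : (u + v) i = (s : ℤ) * (2 * m + 1 : ℝ) := by rw [Pi.add_apply, hui, hvi]; ring
  have hcj : (u + v) j = (t : ℤ) * (2 * m + 1 : ℝ) := by rw [Pi.add_apply, huj, hvj]; ring
  have hci' : |(u + v) i| = 2 * m + 1 := by
    rw [hci, abs_mul, abs_units_cast, one_mul, abs_of_nonneg (by positivity)]
  have hcj' : |(u + v) j| = 2 * m + 1 := by
    rw [hcj, abs_mul, abs_units_cast, one_mul, abs_of_nonneg (by positivity)]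
  have hc : ∀ k, k ≠ i → k ≠ j → (u + v) k = u k + u k := fun k hk hk' => by
    rw [Pi.add_apply, hv' k hk hk']
  have hc' : ∀ k, k ≠ i → k ≠ j → |(u + v) k| = 2 * |u k| := fun k hk hk' => by
    rw [hc k hk hk', abs_add_self]
  have habs : ∀ k, |x k| = |u k| := by
    refine abs_eq_abs_of_order hx hu fun a b hab => ?_
    -- The coefficients at `i` and `j` both have absolute value `2 * m + 1`. This is the only tie,
    -- and `hlt` decides it.
    by_cases hji : a = j ∧ b = i
    · rw [hji.1, hji.2]
      exact hlt
    refine abs_lt_abs_of_maximizes hx hmax ?_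
    by_cases hai : a = i
    · subst hai
      have hbj : b ≠ j := by rintro rfl; linarith
      have hba : b ≠ a := by rintro rfl; exact lt_irrefl _ hab
      rw [hci', hc' b hba hbj]
      linarith
    by_cases haj : a = j
    · subst haj
      have hbi : b ≠ i := fun h => hji ⟨rfl, h⟩
      have hba : b ≠ a := by rintro rfl; exact lt_irrefl _ hab
      rw [hcj', hc' b hbi hba]
      -- Integrality raises `|u b| > m` to `|u b| ≥ m + 1`, so `2 * |u b|` exceeds `2 * m + 1`.
      have := (lt_add_one_iff_abs_le hu b m).not.2 (by linarith)
      linarith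
    rw [hc' a hai haj]
    by_cases hbi : b = i
    · subst hbi
      rw [hui', lt_add_one_iff_abs_le hu] at hab
      rw [hci']
      linarith
    by_cases hbj : b = j
    · subst hbj
      rw [hcj']
      linarith
    rw [hc' b hbi hbj]
    linarith
  have hs : ∀ r : ℤˣ, ((r : ℤ) : ℝ) * (r : ℤ) = 1 := fun r => by
    rcases Int.units_eq_one_or r with rfl | rfl <;> simp
  have hcu : ∀ k, 0 < (u + v) k * u k := fun k => by
    by_cases hki : k = i
    · subst hki
      rw [hci, hui, mul_mul_mul_comm, hs]
      positivity
    by_cases hkj : k = j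
    · subst hkj
      rw [hcj, huj, mul_mul_mul_comm, hs]
      positivity
    rw [hc k hki hkj, add_mul, ← two_mul]
    exact mul_pos two_pos (mul_self_pos.2 (ne_zero_of_mem_signedPerms hu k))
  ext k
  exact eq_of_abs_eq_of_mul_pos (habs k)
    (mul_pos_of_maximizes hx hmax (left_ne_zero_of_mul (hcu k).ne')) (hcu k)

/-- Exchanging two consecutive absolute values gives an edge of the polytope. -/
lemma isExposed_segment_of_exchange {n m : ℕ} {u v : Fin n → ℝ} (hu : u ∈ signedPerms n)
    (hv : v ∈ signedPerms n) {i j : Fin n} (hij : i ≠ j) (hm : 0 < m) {s t : ℤˣ}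
    (hui : u i = (s : ℤ) * (m + 1 : ℝ)) (huj : u j = (t : ℤ) * (m : ℝ))
    (hvi : v i = (s : ℤ) * (m : ℝ)) (hvj : v j = (t : ℤ) * (m + 1 : ℝ))
    (hv' : ∀ k, k ≠ i → k ≠ j → v k = u k) :
    IsExposed ℝ (BPermutahedron n) (segment ℝ u v) := by
  refine isExposed_segment_of_maximizers hu hv fun x hx hmax => ?_
  rcases lt_trichotomy |x i| |x j| with h | h | h
  · rw [add_comm] at hmax
    exact Or.inr (eq_of_maximizes_add hv hx hij.symm hm hvj hvi huj hui
      (fun k hk hk' => (hv' k hk' hk).symm) hmax h)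
  · exact absurd ((mem_signedPerms_iff.1 hx).2 h) hij
  · exact Or.inl (eq_of_maximizes_add hu hx hij hm hui huj hvi hvj hv' hmax h)

/-! ### Words as vertices -/

/-- The point of a signed word: the entries have decreasing absolute values, ending with `1`. -/
noncomputable def wordPoint {n : ℕ} : List (Fin n × ℤˣ) → Fin n → ℝ
  | [] => 0
  | a :: w => Function.update (wordPoint w) a.1 ((a.2 : ℤ) * (w.length + 1 : ℝ))

lemma wordPoint_append_of_notMem {n : ℕ} {a c : List (Fin n × ℤˣ)} {k : Fin n}
    (hk : k ∉ a.map Prod.fst) : wordPoint (a ++ c) k = wordPoint c k := by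
  induction a with
  | nil => rfl
  | cons x a ih =>
    rw [List.map_cons, List.mem_cons, not_or] at hk
    rw [List.cons_append, wordPoint, Function.update_of_ne hk.1, ih hk.2]

lemma wordPoint_append_congr {n : ℕ} (a : List (Fin n × ℤˣ)) {c c' : List (Fin n × ℤˣ)} {k : Fin n}
    (hl : c.length = c'.length) (hk : wordPoint c k = wordPoint c' k) :
    wordPoint (a ++ c) k = wordPoint (a ++ c') k := by
  induction a with
  | nil => exact hk
  | cons x a ih =>
    rw [List.cons_append, List.cons_append, wordPoint, wordPoint]
    by_cases hx : k = x.1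
    · subst hx
      simp [hl]
    · rw [Function.update_of_ne hx, Function.update_of_ne hx, ih]

lemma wordPoint_of_nodup {n : ℕ} {a b : List (Fin n × ℤˣ)} {x : Fin n × ℤˣ}
    (h : ((a ++ x :: b).map Prod.fst).Nodup) :
    wordPoint (a ++ x :: b) x.1 = (x.2 : ℤ) * (b.length + 1 : ℝ) := by
  rw [wordPoint_append_of_notMem, wordPoint, Function.update_self]
  rw [List.map_append, List.nodup_append] at h
  exact fun hx => h.2.2 _ hx x.1 (by simp) rfl

/-- The signed words that contain each letter once. -/
def fullWords (n : ℕ) : Set (List (Fin n × ℤˣ)) :=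
  {w | (w.map Prod.fst).Perm (List.finRange n)}

lemma nodup_of_mem_fullWords {n : ℕ} {w : List (Fin n × ℤˣ)} (hw : w ∈ fullWords n) :
    (w.map Prod.fst).Nodup := List.Perm.nodup_iff hw |>.2 (List.nodup_finRange n)

lemma length_of_mem_fullWords {n : ℕ} {w : List (Fin n × ℤˣ)} (hw : w ∈ fullWords n) :
    w.length = n := by
  have := List.Perm.length_eq hw
  simpa using this

lemma exists_mem_of_mem_fullWords {n : ℕ} {w : List (Fin n × ℤˣ)} (hw : w ∈ fullWords n)
    (i : Fin n) : ∃ s, (i, s) ∈ w := by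
  obtain ⟨x, hx, rfl⟩ := List.mem_map.1 (List.Perm.symm hw |>.subset (List.mem_finRange i))
  exact ⟨x.2, hx⟩

lemma abs_wordPoint {n : ℕ} {a b : List (Fin n × ℤˣ)} {x : Fin n × ℤˣ}
    (h : ((a ++ x :: b).map Prod.fst).Nodup) :
    |wordPoint (a ++ x :: b) x.1| = (b.length + 1 : ℝ) := by
  rw [wordPoint_of_nodup h, abs_mul, abs_units_cast, one_mul, abs_of_nonneg (by positivity)]

lemma wordPoint_mem_signedPerms {n : ℕ} {w : List (Fin n × ℤˣ)} (hw : w ∈ fullWords n) :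
    wordPoint w ∈ signedPerms n := by
  have hdec : ∀ i, ∃ a s b, w = a ++ (i, s) :: b := fun i => by
    obtain ⟨s, hs⟩ := exists_mem_of_mem_fullWords hw i
    obtain ⟨a, b, h⟩ := List.append_of_mem hs
    exact ⟨a, s, b, h⟩
  have hnd := nodup_of_mem_fullWords hw
  have hlen := length_of_mem_fullWords hw
  rw [mem_signedPerms_iff]
  constructor
  · intro i
    obtain ⟨a, s, b, rfl⟩ := hdec i
    refine ⟨b.length, ?_, abs_wordPoint hnd⟩
    rw [List.length_append, List.length_cons] at hlen
    omega
  · intro i j hij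
    obtain ⟨a, s, b, rfl⟩ := hdec i
    obtain ⟨a', s', b', h'⟩ := hdec j
    have h1 : |wordPoint (a ++ (i, s) :: b) j| = (b'.length + 1 : ℝ) := by
      rw [h'] at hnd ⊢
      exact abs_wordPoint hnd
    simp only [h1, abs_wordPoint hnd, add_left_inj, Nat.cast_inj] at hij
    have := (List.append_inj' h' (by simp [hij])).2
    simp only [List.cons.injEq, Prod.mk.injEq] at this
    exact this.1.1

/-- The sign of a coordinate is the sign of its letter, and its absolute value is one more than the
number of letters behind it. -/
lemma wordPoint_injOn (n : ℕ) : Set.InjOn (wordPoint (n := n)) (fullWords n) := by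
  intro w hw w' hw' h
  have hl := length_of_mem_fullWords hw
  have hl' := length_of_mem_fullWords hw'
  refine List.ext_getElem (hl.trans hl'.symm) fun k hk hk' => ?_
  have hnd := nodup_of_mem_fullWords hw
  have hnd' := nodup_of_mem_fullWords hw'
  have hdec : w = w.take k ++ w[k] :: w.drop (k + 1) := by simp
  obtain ⟨s, hs⟩ := exists_mem_of_mem_fullWords hw' w[k].1
  obtain ⟨a, b, hab⟩ := List.append_of_mem hs
  have key : ∀ v : List (Fin n × ℤˣ), (v.map Prod.fst).Nodup → ∀ a x b, v = a ++ x :: b →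
      wordPoint v x.1 = (x.2 : ℤ) * (b.length + 1 : ℝ) := by
    rintro _ h a x b rfl
    exact wordPoint_of_nodup h
  have h1 := key w hnd _ _ _ hdec
  have h2 := key w' hnd' _ _ _ hab
  rw [h, h2] at h1
  have h3 := congrArg abs h1
  simp only [abs_mul, abs_units_cast, one_mul] at h3
  rw [abs_of_nonneg (by positivity), abs_of_nonneg (by positivity), add_left_inj, Nat.cast_inj] at h3
  rw [← h3] at h1
  have h4 : s = w[k].2 := by
    have := mul_right_cancel₀ (by positivity) h1
    exact_mod_cast this
  have ha : a.length = k := by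
    have := congrArg List.length hab
    rw [List.length_append, List.length_cons] at this
    rw [List.length_drop] at h3
    omega
  simp [hab, ← ha, h4]

/-- Adjacent full words give the ends of an edge of the polytope. -/
lemma isExposed_segment_of_adj {n : ℕ} {w w' : List (Fin n × ℤˣ)} (hw : w ∈ fullWords n)
    (hw' : w' ∈ fullWords n) (h : (signedWordGraph (Fin n)).Adj w w') :
    IsExposed ℝ (BPermutahedron n) (segment ℝ (wordPoint w) (wordPoint w')) := by
  have hu := wordPoint_mem_signedPerms hw
  have hv := wordPoint_mem_signedPerms hw'
  have hnd := nodup_of_mem_fullWords hw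
  have hnd' := nodup_of_mem_fullWords hw'
  rcases h with ⟨a, x, y, b, -, rfl, rfl⟩ | ⟨a, x, rfl, rfl⟩
  · have hxy : x.1 ≠ y.1 := by
      intro h
      simp [h, List.nodup_append] at hnd
    refine isExposed_segment_of_exchange (m := b.length + 1) (s := x.2) (t := y.2) hu hv hxy
      (Nat.succ_pos _) ?_ ?_ ?_ ?_ ?_
    · rw [wordPoint_of_nodup hnd, List.length_cons]
    · rw [List.append_cons] at hnd ⊢
      rw [wordPoint_of_nodup hnd]
      push_cast
      rfl
    · rw [List.append_cons] at hnd' ⊢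
      rw [wordPoint_of_nodup hnd']
      push_cast
      rfl
    · rw [wordPoint_of_nodup hnd', List.length_cons]
    · intro k hk hk'
      refine wordPoint_append_congr a (by simp) ?_
      simp [wordPoint, Function.update_of_ne hk, Function.update_of_ne hk']
  · refine isExposed_segment_of_neg hu hv (i := x.1) ?_ ?_ fun k hk => ?_
    · rw [abs_wordPoint hnd]
      simp
    · have h' := wordPoint_of_nodup hnd'
      rw [negLetter_fst] at h'
      rw [wordPoint_of_nodup hnd, h']
      simp [negLetter]
    · refine wordPoint_append_congr a (by simp) ?_
      simp [wordPoint, Function.update_of_ne hk]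

/-- The coordinates of `x` in the support of `σ` have the signs given by `σ` and larger absolute
values than the others. -/
def IsLeading {n : ℕ} (σ : Fin n → Option ℤˣ) (x : Fin n → ℝ) : Prop :=
  (∀ i s, σ i = some s → 0 < ((s : ℤ) : ℝ) * x i) ∧
    ∀ i j, σ i ≠ none → σ j = none → |x j| < |x i|

lemma units_cast_mul_self (s : ℤˣ) : ((s : ℤ) : ℝ) * (s : ℤ) = 1 := by
  rcases Int.units_eq_one_or s with rfl | rfl <;> simp

lemma units_eq_of_mul_pos {s t : ℤˣ} {a : ℝ} (ha : 0 < a) (h : 0 < ((s : ℤ) : ℝ) * ((t : ℤ) * a)) :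
    s = t := by
  by_contra hne
  rw [eq_neg_of_ne_units hne, Units.val_neg, Int.cast_neg, neg_mul, ← mul_assoc,
    units_cast_mul_self, one_mul] at h
  linarith

/-- Absolute values decrease along a word, so the coordinates that dominate all others are those of
a prefix. -/
lemma isPrefixSigns_iff_isLeading {n : ℕ} {w : List (Fin n × ℤˣ)} (hw : w ∈ fullWords n)
    (σ : Fin n → Option ℤˣ) : IsPrefixSigns σ w ↔ IsLeading σ (wordPoint w) := by
  have hnd := nodup_of_mem_fullWords hw
  constructor
  · rintro ⟨k, hk⟩
    have htake : ∀ {i s}, σ i = some s → ∃ a b, w = a ++ (i, s) :: (b ++ w.drop k) := by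
      intro i s his
      obtain ⟨a, b, hab⟩ := List.append_of_mem ((hk i s).2 his)
      refine ⟨a, b, ?_⟩
      conv_lhs => rw [← List.take_append_drop k w, hab]
      simp
    constructor
    · intro i s his
      obtain ⟨a, b, hab⟩ := htake his
      generalize w.drop k = d at hab
      subst hab
      rw [wordPoint_of_nodup (x := (i, s)) hnd, ← mul_assoc, units_cast_mul_self, one_mul]
      positivity
    · intro i j hi hj
      obtain ⟨s, his⟩ := Option.ne_none_iff_exists'.1 hi
      obtain ⟨a, b, hab⟩ := htake his
      obtain ⟨t, ht⟩ := exists_mem_of_mem_fullWords hw j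
      rw [← List.take_append_drop k w, List.mem_append, hk, hj] at ht
      obtain ⟨c, d, hcd⟩ := List.append_of_mem (ht.resolve_left (by simp))
      rw [hcd] at hab
      subst hab
      rw [abs_wordPoint (x := (i, s)) hnd]
      have h2 : a ++ (i, s) :: (b ++ (c ++ (j, t) :: d)) =
        (a ++ (i, s) :: (b ++ c)) ++ (j, t) :: d := by simp
      rw [h2] at hnd ⊢
      rw [abs_wordPoint (x := (j, t)) hnd]
      simp only [List.length_append, List.length_cons, Nat.cast_add, Nat.cast_one]
      linarith [(Nat.cast_nonneg b.length : (0 : ℝ) ≤ b.length),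
        (Nat.cast_nonneg c.length : (0 : ℝ) ≤ c.length)]
  · rintro ⟨h₁, h₂⟩
    have hsign : ∀ {i s t}, σ i = some s → (i, t) ∈ w → s = t := by
      intro i s t his hit
      have := h₁ i s his
      obtain ⟨a, b, rfl⟩ := List.append_of_mem hit
      rw [wordPoint_of_nodup (x := (i, t)) hnd] at this
      exact units_eq_of_mul_pos (by positivity) this
    -- The prefix stops at the first letter outside the support of `σ`; a letter of the support
    -- behind it would have a smaller absolute value.
    set T := w.takeWhile fun a => (σ a.1).isSome with hT
    have hw' : T ++ w.dropWhile (fun a => (σ a.1).isSome) = w := List.takeWhile_append_dropWhile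
    have hTk : w.take T.length = T := by
      conv_lhs => rw [← hw']
      simp
    refine ⟨T.length, fun i s => ?_⟩
    rw [hTk]
    constructor
    · intro his
      obtain ⟨t, ht⟩ := Option.isSome_iff_exists.1
        (List.mem_takeWhile_imp (p := fun a : Fin n × ℤˣ => (σ a.1).isSome) his)
      rw [ht, hsign ht (hw' ▸ List.mem_append_left _ his)]
    · intro his
      obtain ⟨t, ht⟩ := exists_mem_of_mem_fullWords hw i
      rw [← hsign his ht] at ht
      have ht' := ht
      rw [← hw', List.mem_append] at ht'
      refine ht'.resolve_right fun hR => ?_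
      cases hR' : w.dropWhile (fun a => (σ a.1).isSome) with
      | nil => simp [hR'] at hR
      | cons x R =>
        have hx : σ x.1 = none := by
          have := List.head_dropWhile_not (fun a : Fin n × ℤˣ => (σ a.1).isSome) (l := w)
            (by simp [hR'])
          simpa [hR'] using this
        rw [hR', List.mem_cons] at hR
        rcases hR with rfl | hR
        · rw [hx] at his
          simp at his
        · obtain ⟨c, d, rfl⟩ := List.append_of_mem hR
          have h3 := h₂ i x.1 (by simp [his]) hx
          rw [hR'] at hw'
          generalize T = T' at hw'
          subst hw'
          rw [abs_wordPoint hnd] at h3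
          have h4 : T' ++ x :: (c ++ (i, s) :: d) = (T' ++ x :: c) ++ (i, s) :: d := by simp
          rw [h4] at hnd h3
          rw [abs_wordPoint (x := (i, s)) hnd] at h3
          simp only [List.length_append, List.length_cons, Nat.cast_add, Nat.cast_one] at h3
          linarith [(Nat.cast_nonneg c.length : (0 : ℝ) ≤ c.length)]

/-! ### Facets of the polytope -/

/-- The vector with entries `± 1` and `0` given by `σ`. -/
noncomputable def signVector {n : ℕ} (σ : Fin n → Option ℤˣ) (i : Fin n) : ℝ :=
  (σ i).elim 0 fun s => ((s : ℤ) : ℝ)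

/-- Finsets of the same size that contain larger elements than their complements are equal. -/
lemma eq_of_card_eq_of_forall_lt {α : Type*} [LinearOrder α] {A B : Finset α}
    (h : A.card = B.card) (hA : ∀ a ∈ A, ∀ b ∉ A, b < a) (hB : ∀ a ∈ B, ∀ b ∉ B, b < a) :
    A = B := by
  by_contra hne
  obtain ⟨a, ha, ha'⟩ := Finset.not_subset.1 fun hs => hne (Finset.eq_of_subset_of_card_le hs h.ge)
  obtain ⟨b, hb, hb'⟩ := Finset.not_subset.1
    fun hs => hne (Finset.eq_of_subset_of_card_le hs h.le).symm
  exact lt_asymm (hA a ha b hb') (hB b hb a ha')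

/-- The product is the sum of the absolute values over the support of `σ`. For leading points these
are the largest values available, whatever their arrangement. -/
lemma signVector_dotProduct_eq {n : ℕ} {σ : Fin n → Option ℤˣ} {x y : Fin n → ℝ}
    (hx : x ∈ signedPerms n) (hy : y ∈ signedPerms n) (hxσ : IsLeading σ x) (hyσ : IsLeading σ y) :
    signVector σ ⬝ᵥ x = signVector σ ⬝ᵥ y := by
  classical
  let A : Finset (Fin n) := Finset.univ.filter fun i => σ i ≠ none
  have hsum : ∀ z, IsLeading σ z → signVector σ ⬝ᵥ z = ∑ i ∈ A, |z i| := by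
    intro z hz
    rw [dotProduct, Finset.sum_filter]
    refine Finset.sum_congr rfl fun i _ => ?_
    cases his : σ i with
    | none => simp [signVector, his]
    | some s =>
      have h := hz.1 i s his
      simp only [signVector, his, Option.elim_some, ne_eq, reduceCtorEq, not_false_eq_true, if_true]
      rw [← abs_of_pos h, abs_mul, abs_units_cast, one_mul]
  obtain ⟨π, hπ⟩ := exists_perm_of_mem_signedPerms hx
  obtain ⟨ρ, hρ⟩ := exists_perm_of_mem_signedPerms hy
  have hup : ∀ (τ : Equiv.Perm (Fin n)) (z : Fin n → ℝ), (∀ i, |z i| = (τ i : ℕ) + 1) →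
      IsLeading σ z → ∀ a ∈ A.map τ.toEmbedding, ∀ b ∉ A.map τ.toEmbedding, b < a := by
    intro τ z hτ hz a ha b hb
    rw [Finset.mem_map_equiv] at ha hb
    have := hz.2 (τ.symm a) (τ.symm b) (by simpa [A] using ha) (by simpa [A] using hb)
    simpa [hτ] using this
  have hmap : A.map π.toEmbedding = A.map ρ.toEmbedding :=
    eq_of_card_eq_of_forall_lt (by simp) (hup π x hπ hxσ) (hup ρ y hρ hyσ)
  have key : ∀ τ : Equiv.Perm (Fin n), ∑ i ∈ A, (((τ i : ℕ) : ℝ) + 1) =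
      ∑ k ∈ A.map τ.toEmbedding, (((k : ℕ) : ℝ) + 1) := fun τ => by simp
  rw [hsum x hxσ, hsum y hyσ, Finset.sum_congr rfl fun i _ => hπ i,
    Finset.sum_congr rfl fun i _ => hρ i, key, key, hmap]

lemma polytopeDim_BPermutahedron (n : ℕ) : polytopeDim (BPermutahedron n) = n := by
  have htop : vectorSpan ℝ (BPermutahedron n) = ⊤ := by
    have hx : signedPermPoint 1 1 ∈ signedPerms n := ⟨1, 1, rfl⟩
    set x : Fin n → ℝ := signedPermPoint 1 1
    have hVP : signedPerms n ⊆ BPermutahedron n := subset_convexHull ℝ _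
    have hmem : ∀ i, Pi.single i (1 : ℝ) ∈ vectorSpan ℝ (BPermutahedron n) := fun i => by
      have h := vsub_mem_vectorSpan ℝ
        (hVP (update_neg_mem_signedPerms hx i)) (hVP hx)
      have h0 := ne_zero_of_mem_signedPerms hx i
      convert Submodule.smul_mem _ (-2 * x i)⁻¹ h using 1
      rw [vsub_eq_sub, add_sub_cancel_left, ← Pi.single_smul, smul_eq_mul,
        inv_mul_cancel₀ (by simpa using h0)]
    rw [Submodule.eq_top_iff']
    intro y
    rw [pi_eq_sum_univ' y]
    exact Submodule.sum_mem _ fun i _ => Submodule.smul_mem _ _ (hmem i)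
  rw [polytopeDim, htop, finrank_top, Module.finrank_fin_fun]

lemma vectorSpan_le_ker {E : Type*} [AddCommGroup E] [Module ℝ E] {F : Set E} {f : E →ₗ[ℝ] ℝ}
    {L : ℝ} (h : ∀ x ∈ F, f x = L) : vectorSpan ℝ F ≤ LinearMap.ker f := by
  rw [vectorSpan_def, Submodule.span_le]
  rintro _ ⟨x, hx, y, hy, rfl⟩
  simp [h x hx, h y hy]

/-- In codimension one the direction of `F` is already a hyperplane, so any two nonzero functionals
constant on `F` have the same kernel. -/
lemma ker_eq_of_constant_on {E : Type*} [AddCommGroup E] [Module ℝ E] [FiniteDimensional ℝ E]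
    {F : Set E} (hF : polytopeDim F + 1 = Module.finrank ℝ E) {f : E →ₗ[ℝ] ℝ} (hf : f ≠ 0) {L : ℝ}
    (h : ∀ x ∈ F, f x = L) : vectorSpan ℝ F = LinearMap.ker f := by
  refine Submodule.eq_of_le_of_finrank_eq (vectorSpan_le_ker h) ?_
  have := Module.Dual.finrank_ker_add_one_of_ne_zero hf
  rw [polytopeDim] at hF
  omega

/-- Every facet of the polytope is given by prefix signs. -/
lemma IsFacet.exists_prefixSigns {n : ℕ} {F : Set (Fin n → ℝ)}
    (hF : IsFacet (BPermutahedron n) F) :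
    ∃ σ : Fin n → Option ℤˣ, σ ≠ (fun _ => none) ∧
      ∀ w ∈ fullWords n, wordPoint w ∈ F ↔ IsPrefixSigns σ w := by
  classical
  obtain ⟨hne, hexp, hdim⟩ := hF
  rw [polytopeDim_BPermutahedron] at hdim
  obtain ⟨l, hl⟩ := hexp hne
  obtain ⟨x₀, hx₀⟩ := hne
  set c : Fin n → ℝ := fun i => l (Pi.single i 1) with hc
  have hlc : ∀ x, l x = c ⬝ᵥ x := strongDual_eq_dotProduct l
  set L := l x₀ with hL
  have hVP : signedPerms n ⊆ BPermutahedron n := subset_convexHull ℝ _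
  have hx₀' : x₀ ∈ BPermutahedron n ∧ ∀ y ∈ BPermutahedron n, l y ≤ L := by
    rw [hl] at hx₀
    exact hx₀
  have hFL : ∀ x, x ∈ F ↔ x ∈ BPermutahedron n ∧ l x = L := fun x => by
    rw [hl]
    constructor
    · exact fun hx => ⟨hx.1, le_antisymm (hx₀'.2 x hx.1) (hx.2 x₀ hx₀'.1)⟩
    · rintro ⟨hx, hx'⟩
      exact ⟨hx, fun y hy => hx' ▸ hx₀'.2 y hy⟩
  have hc0 : c ≠ 0 := by
    intro h
    have hFP : F = BPermutahedron n := by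
      ext x
      rw [hFL, hL, hlc, hlc, h]
      simp
    rw [hFP, polytopeDim_BPermutahedron] at hdim
    omega
  have hl0 : (l : (Fin n → ℝ) →ₗ[ℝ] ℝ) ≠ 0 := by
    intro h
    refine hc0 (funext fun i => ?_)
    exact LinearMap.congr_fun h (Pi.single i 1)
  obtain ⟨i₁, hi₁⟩ := Function.ne_iff.1 hc0
  obtain ⟨i₀, -, hi₀⟩ := Finset.exists_max_image Finset.univ (fun i => |c i|) ⟨i₁, Finset.mem_univ _⟩
  have hi₀pos : 0 < |c i₀| := (abs_pos.2 hi₁).trans_le (hi₀ i₁ (Finset.mem_univ _))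
  -- The support of `σ` is where `|c|` is largest, with the signs of `c`. Maximizers must lead there
  -- by the exchange arguments; conversely, the facet dimension will show that `c` is proportional
  -- to `signVector σ`.
  let σ : Fin n → Option ℤˣ := fun i =>
    if |c i| = |c i₀| then some (if 0 < c i then 1 else -1) else none
  have hσ₀ : σ i₀ ≠ none := by simp [σ]
  have hlead : ∀ x ∈ signedPerms n, l x = L → IsLeading σ x := by
    intro x hx hxL
    have hmax : ∀ y ∈ signedPerms n, c ⬝ᵥ y ≤ c ⬝ᵥ x := fun y hy => by
      rw [← hlc, ← hlc, hxL]
      exact hx₀'.2 y (hVP hy)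
    constructor
    · intro i s his
      have hi : |c i| = |c i₀| := by
        by_contra h
        simp [σ, h] at his
      have hci : c i ≠ 0 := abs_pos.1 (hi ▸ hi₀pos)
      have hpos := mul_pos_of_maximizes hx hmax hci
      simp only [σ, hi, if_true, Option.some.injEq] at his
      subst his
      split_ifs with h0
      · simpa using (pos_iff_pos_of_mul_pos hpos).1 h0
      · have := (neg_iff_neg_of_mul_pos hpos).1 (lt_of_le_of_ne (not_lt.1 h0) hci)
        simpa using this
    · intro i j hi hj
      have hi : |c i| = |c i₀| := by
        by_contra h
        simp [σ, h] at hi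
      have hj : |c j| ≠ |c i₀| := by
        intro h
        simp [σ, h] at hj
      exact abs_lt_abs_of_maximizes hx hmax
        (hi ▸ lt_of_le_of_ne (hi₀ j (Finset.mem_univ _)) hj)
  -- If no generator attained the maximum, the maximizers would lie in the convex set `∅`.
  obtain ⟨v, hv, hvL⟩ : ∃ v ∈ signedPerms n, l v = L := by
    by_contra! h
    exact (le_and_mem_of_mem_convexHull (K := ∅) convex_empty (l := l)
      l.toLinearMap.isLinear (fun v hv => ⟨hx₀'.2 v (hVP hv), fun h' => h v hv h'⟩) hx₀'.1).2 rfl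
  set m := dotFunctional (signVector σ) with hm
  have hmV : ∀ x ∈ signedPerms n, IsLeading σ x → m x = m v := fun x hx hxσ => by
    rw [hm, dotFunctional_apply, dotFunctional_apply]
    exact signVector_dotProduct_eq hx hv hxσ (hlead v hv hvL)
  have hmF : ∀ x ∈ F, m x = m v := fun x hx => by
    obtain ⟨hxP, hxL⟩ := (hFL x).1 hx
    refine (le_and_mem_of_mem_convexHull (K := {x | m x = m v}) ?_ (l := l)
      l.toLinearMap.isLinear (fun z hz => ⟨hx₀'.2 z (hVP hz), fun hzL => ?_⟩) hxP).2 hxL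
    · exact convex_hyperplane m.toLinearMap.isLinear _
    · exact hmV z hz (hlead z hz hzL)
  have hm₀ : m (Pi.single i₀ 1) ≠ 0 := by
    rw [hm, dotFunctional_apply, dotProduct_single, mul_one]
    obtain ⟨s, hs⟩ := Option.ne_none_iff_exists'.1 hσ₀
    simp [signVector, hs]
  have hm0 : (m : (Fin n → ℝ) →ₗ[ℝ] ℝ) ≠ 0 := fun h =>
    hm₀ (LinearMap.congr_fun h (Pi.single i₀ 1))
  have hker : LinearMap.ker (m : (Fin n → ℝ) →ₗ[ℝ] ℝ) = LinearMap.ker (l : (Fin n → ℝ) →ₗ[ℝ] ℝ) := by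
    rw [← ker_eq_of_constant_on (by simpa using hdim) hm0 hmF,
      ← ker_eq_of_constant_on (by simpa using hdim) hl0 fun x hx => ((hFL x).1 hx).2]
  refine ⟨σ, fun h => hσ₀ (congrFun h i₀), fun w hw => ?_⟩
  have hwV := wordPoint_mem_signedPerms hw
  rw [isPrefixSigns_iff_isLeading hw, hFL]
  refine ⟨fun h => hlead _ hwV h.2, fun h => ⟨hVP hwV, ?_⟩⟩
  have h0 : wordPoint w - v ∈ LinearMap.ker (m : (Fin n → ℝ) →ₗ[ℝ] ℝ) := by
    simp [hmV _ hwV h]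
  rw [hker] at h0
  have h1 : l (wordPoint w) - l v = 0 := by simpa using h0
  linarith

/-! ### Transfer of the cycle to the skeleton -/

/-- The map from full signed words to the skeleton of the polytope. -/
noncomputable def wordHom (n : ℕ) :
    (signedWordGraph (Fin n)).induce (fullWords n) →g skeleton (BPermutahedron n) where
  toFun w := ⟨wordPoint w.1, mem_exposedPoints_of_mem_signedPerms (wordPoint_mem_signedPerms w.2)⟩
  map_rel' := by
    intro w w' h
    refine ⟨fun heq => ?_, isExposed_segment_of_adj w.2 w'.2 h⟩
    exact h.ne (Subtype.ext (wordPoint_injOn n w.2 w'.2 (congrArg Subtype.val heq)))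

lemma wordHom_injective (n : ℕ) : Function.Injective (wordHom n) := fun w w' h =>
  Subtype.ext (wordPoint_injOn n w.2 w'.2 (congrArg Subtype.val h))

/-- A nonempty set of prefix signs is avoided by the words in which one of the signs differs. -/
lemma exists_not_isPrefixSigns {ι : Type*} [DecidableEq ι] {σ : ι → Option ℤˣ}
    (hσ : σ ≠ fun _ => none) :
    ∃ τ : ι → Option ℤˣ, ∀ w : List (ι × ℤˣ), (w.map Prod.fst).Nodup → IsPrefixSigns τ w →
      ¬ IsPrefixSigns σ w := by
  obtain ⟨i, hi⟩ := Function.ne_iff.1 hσ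
  obtain ⟨s, hs⟩ := Option.ne_none_iff_exists'.1 hi
  -- Reversing one sign of `σ` suffices, as a word contains each index with only one sign.
  refine ⟨Function.update σ i (some (-s)), fun w hw ⟨k, hk⟩ ⟨m, hm⟩ => ?_⟩
  have h₁ := List.mem_of_mem_take ((hk i (-s)).2 (by simp))
  have h₂ := List.mem_of_mem_take ((hm i s).2 hs)
  have := congrArg Prod.snd (eq_of_fst_eq_of_nodup hw h₂ h₁ rfl)
  exact units_ne_neg_self s this

theorem theorem6p2 (n : ℕ) (hn : 2 ≤ n) :
    ∃ (v : (BPermutahedron n).exposedPoints ℝ) (c : (skeleton (BPermutahedron n)).Walk v v),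
      IsFacetHamiltonianCycle (BPermutahedron n) c := by
  obtain ⟨m, rfl⟩ : ∃ m, n = m + 1 := ⟨n - 1, by omega⟩
  let p : List (Fin (m + 1) × ℤˣ) := (List.finRange m).map fun i => (i.castSucc, 1)
  let x : Fin (m + 1) × ℤˣ := (Fin.last m, 1)
  have hpx : (p ++ [x]).map Prod.fst = List.finRange (m + 1) := by
    rw [List.finRange_succ_last]
    simp [p, x, Function.comp_def]
  have hp : p ≠ [] := by
    intro h
    have := congrArg List.length h
    simp only [p, List.length_map, List.length_finRange, List.length_nil] at this
    omega
  obtain ⟨u, c, hcyc, hlen, hperm, hcov⟩ :=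
    exists_signed_cycle p hp x (hpx ▸ List.nodup_finRange _)
  rw [hpx] at hperm hcov
  have hfull : ∀ w ∈ c.support, w ∈ fullWords (m + 1) := hperm
  have hentry : ∀ σ : Fin (m + 1) → Option ℤˣ, σ ≠ (fun _ => none) →
      ∃ t < c.length, ¬ IsPrefixSigns σ (c.getVert t) ∧ IsPrefixSigns σ (c.getVert (t + 1)) := by
    intro σ hσ
    obtain ⟨τ, hτ⟩ := exists_not_isPrefixSigns hσ
    obtain ⟨w, hw, hwσ⟩ := hcov σ fun i _ => List.mem_finRange i
    obtain ⟨w', hw', hwτ⟩ := hcov τ fun i _ => List.mem_finRange i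
    exact c.exists_entry (IsPrefixSigns σ) hw hwσ hw'
      (hτ w' (nodup_of_mem_fullWords (hfull w' hw')) hwτ)
  -- Only full words map to vertices, so the cycle is first restricted to them.
  let c' := c.induce (fullWords (m + 1)) hfull
  have hc' : c'.map (Embedding.induce (fullWords (m + 1))).toHom = c := Walk.map_induce ..
  have hvert : ∀ t, (c'.getVert t).1 = c.getVert t := fun t =>
    (Walk.getVert_map (Embedding.induce (fullWords (m + 1))).toHom c' t).symm.trans
      (congrArg (fun d => d.getVert t) hc')
  have hlen' : c'.length = c.length :=
    (Walk.length_map (Embedding.induce (fullWords (m + 1))).toHom c').symm.trans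
      (congrArg Walk.length hc')
  refine ⟨_, c'.map (wordHom (m + 1)), ?_, fun F hF => ?_⟩
  · refine (Walk.isCycle_map_iff_of_injective (wordHom_injective _)).2 ?_
    refine Walk.IsCycle.of_map (f := (Embedding.induce (fullWords (m + 1))).toHom) ?_
    rw [hc']
    exact hcyc
  · obtain ⟨σ, hσ, hFσ⟩ := hF.exists_prefixSigns
    have hQ : ∀ t, (((c'.map (wordHom (m + 1))).getVert t : Fin (m + 1) → ℝ) ∈ F) ↔
        IsPrefixSigns σ (c.getVert t) := fun t => by
      rw [Walk.getVert_map, ← hvert]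
      exact hFσ _ (c'.getVert t).2
    refine Walk.connected_inf_induce_of_unique_entry _
      (fun v : (BPermutahedron (m + 1)).exposedPoints ℝ => (v : Fin (m + 1) → ℝ) ∈ F) ?_ ?_
    · simpa only [hQ, Walk.length_map, hlen'] using hentry σ hσ
    · simp only [hQ, Walk.length_map, hlen']
      intro s hs t ht h₁ h₂ h₃ h₄
      refine entry_unique c ?_ hentry hs ht h₁ h₂ h₃ h₄
      rw [hlen]
      simp [p]
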